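/- **Setting.** Let $(\mathcal S,\mathcal A,P)$ be a Markov decision process with finite action space $\mathcal A$, reward $R_t=\mathcal R(S_t)$ with $|\mathcal R|\le R_{\max}$, let $0\le c<1$, and let $\pi$ be a stationary policy. Let $d^\pi$ be the stationary distribution of the state chain induced by $\pi$, and assume that it has a density with respect to a $\sigma$-finite reference measure on $\mathcal S$ (e.g. Lebesgue measure). Put $r_\beta(s)=\beta-\frac1{1-c}(\beta-\mathcal R(s))_+$ and $$M(\beta,\pi)=\beta-\tfrac1{1-c}\mathbb E_{d^\pi}[(\beta-\mathcal R(S))_+],\qquad U^{\pi,\beta}(s,a,s')=\sum_{a'}\pi(a'|s')Q^{\pi,\beta}(s',a')-Q^{\pi,\beta}(s,a),$$ where the relative value function $$Q^{\pi,\beta}(s,a)=\lim_{t^*\to\infty}\frac1{t^*}\sum_{t=1}^{t^*}\mathbb E_\pi\Big[\sum_{k=1}^t\{r_\beta(S_k)-M(\beta,\pi)\}\,\Big|\,S_1=s,A_1=a\Big]$$ is assumed to exist. **Data.** One observes $n$ i.i.d. trajectories of $T_0$ transitions $Z_t=(S_t,A_t,S_{t+1})$, $1\le t\le T_0$, generated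 by a stationary behavior policy; $N=nT_0$, and $\mathbb P_N f$ is the average of $f$ over the $N$ observed transitions. The process $(S_t,A_t)_{t\ge1}$ is stationary, exponentially $\boldsymbol\beta$-mixing, and $(S_t,A_t)$ has a density (with respect to the reference measure times counting measure) bounded below by some $p_{\min}>0$. Write $\|g\|^2=\mathbb E[g^2(Z_1)]$, and let $\omega^\pi$ be the density of $d^\pi(ds)\,\pi(a|s)$ with respect to the law of $(S_t,A_t)$. Assume that $\omega^\pi$ is bounded and that, with $\mathcal P^\pi f(s,a)=\mathbb E_\pi[f(S_{t+1},A_{t+1})|S_t=s,A_t=a]$ and $d^\pi(f)=\int f(s,a)\,d^\pi(ds)\,\pi(da|s)$, one has $\|(\mathcal P^\pi)^tf-d^\pi(f)\|\le C_3\|f\|\bar\alpha_t$ for all $t\ge1$ and all $f$ with $\|f\|<\infty$, where $\bar\alpha_t>0$ and $\bar\alpha_t\to0$. **Estimators.** Let $\mathcal F_1,\mathcal F_2,\mathcal G_1,\mathcal G_2$ be uniformly bounded classes of measurable functions on $\mathcal S\times\mathcal A$ and let $J_1,J_2\ge0$ be penalties such that, for some $\alpha\in(0,1)$, $C_4>0$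 and all $\epsilon,M>0$, the sets $\{f\in\mathcal F_j:J_1(f)\le M\}$ and $\{g\in\mathcal G_j:J_2(g)\le M\}$ have sup-norm $\epsilon$-covering numbers at most $\exp\{C_4(M/\epsilon)^{2\alpha}\}$. The tuning parameters $\lambda_{1N},\mu_{1N},\lambda_{2N},\mu_{2N}$ are at least of the order $(\log N)^{\frac{2+\alpha}{1+\alpha}}N^{-\frac1{1+\alpha}}$. * $(\widehat\eta,\widehat Q^{\pi,\beta}_N)$ minimizes $\mathbb P_N[\widehat g(S,A;\eta,Q)^2]+\lambda_{1N}J_1^2(Q)$ over $\mathbb R\times\mathcal F_1$, where $\widehat g(\cdot;\eta,Q)$ minimizes $\mathbb P_N[(r_\beta(S)+\sum_{a'}\pi(a'|S')Q(S',a')-Q(S,A)-\eta-g(S,A))^2]+\mu_{1N}J_2^2(g)$ over $g\in\mathcal G_1$; and $\widehat U^{\pi,\beta}_N(s,a,s')=\sum_{a'}\pi(a'|s')\widehat Q^{\pi,\beta}_N(s',a')-\widehat Q^{\pi,\beta}_N(s,a)$. * $\widehat e_N=\widehat h(\cdot;\widehat H)$, where $\widehat H$ minimizes $\mathbb P_N[\widehat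 h(S,A;H)^2]+\lambda_{2N}J_1^2(H)$ over $\mathcal F_2$ and $\widehat h(\cdot;H)$ minimizes $\mathbb P_N[(1-H(S,A)+\sum_{a'}\pi(a'|S')H(S',a')-h(S,A))^2]+\mu_{2N}J_2^2(h)$ over $h\in\mathcal G_2$; and $\widehat\omega^\pi_N=\widehat e_N/\mathbb P_N[\widehat e_N(S,A)]$, where the normalizing constants $\mathbb P_N[\widehat e_N(S,A)]$ are bounded away from $0$ in probability. * $\displaystyle\widehat M_N(\beta,\pi)=\frac{\mathbb P_N\{\widehat\omega^\pi_N(S,A)[r_\beta(S)+\widehat U^{\pi,\beta}_N(S,A,S')]\}}{\mathbb P_N\{\widehat\omega^\pi_N(S,A)\}}.$ All minimizers are assumed to exist and may be chosen arbitrarily. **Claim.** Let $N=nT_0\to\infty$ along any sequence of pairs $(n,T_0)$, and suppose that $\|\widehat\omega^\pi_N-\bar\omega\|\to0$ in probability for some $\bar\omega$. 1. If $\|\widehat U^{\pi,\beta}_N-\bar U\|\to0$ in probability for some $\bar U$, and either $\bar U=U^{\pi,\beta}$ or $\bar\omega=\omega^\pi$ (almost everywhere under the law of the data), then $\widehat M_N(\beta,\pi)\to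 M(\beta,\pi)$ in probability. 2. Suppose that for every $\beta\in\mathbb R$, $\|\widehat U^{\pi,\beta}_N-\bar U^\beta\|\to0$ in probability for some $\bar U^\beta$, and that either $\bar\omega=\omega^\pi$, or $\bar U^\beta=U^{\pi,\beta}$ for all $\beta$ and the convergence is uniform, i.e. $\sup_{\beta\in\mathbb R}\|\widehat U^{\pi,\beta}_N-\bar U^\beta\|\to0$ in probability. Then $\max_{\beta\in\mathbb R}M(\beta,\pi)$ is attained, and $\sup_{\beta\in\mathbb R}\widehat M_N(\beta,\pi)$ is finite with probability tending to one and converges to $\max_{\beta\in\mathbb R}M(\beta,\pi)$ in probability. -/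

import Mathlib

open MeasureTheory ProbabilityTheory Filter Topology
open scoped NNReal ENNReal

noncomputable section

namespace AvgMDP

/-! ### Markov decision processes, policies and the population quantities

The state space is `S`, the finite action space is `A`, a state-action pair has type `S × A`, and a
transition tuple `(s, a, s')` has type `(S × A) × S`.  Time starts at `0`. -/

section Population

variable {S A : Type*} [MeasurableSpace S] [MeasurableSpace A]

/-- The state chain induced by a policy: `s ↦ a ∼ π(· | s) ↦ s' ∼ P(· | s, a)`. -/
def stateKernel (P : Kernel (S × A) S) (π : Kernel S A) : Kernel S S :=
  P ∘ₖ (Kernel.id ×ₖ π)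

/-- The state-action chain induced by a policy: `(s, a) ↦ s' ∼ P(· | s, a) ↦ (s', a')` with
`a' ∼ π(· | s')`. -/
def pairKernel (P : Kernel (S × A) S) (π : Kernel S A) : Kernel (S × A) (S × A) :=
  (Kernel.id ×ₖ π) ∘ₖ P

/-- The modified reward `β - (β - R(s))₊ / (1 - c)`. -/
def modReward (c : ℝ) (R : S → ℝ) (β : ℝ) (s : S) : ℝ :=
  β - 1 / (1 - c) * max (β - R s) 0

/-- `M(β, π) = β - E_{d^π}[(β - R(S))₊] / (1 - c)`, where `d` is the stationary law `d^π`. -/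
def objective (c : ℝ) (R : S → ℝ) (d : Measure S) (β : ℝ) : ℝ :=
  β - 1 / (1 - c) * ∫ s, max (β - R s) 0 ∂d

/-- `∑_{a'} π(a' | s') Q(s', a')`. -/
def policyMean [Fintype A] (π : Kernel S A) (Q : S × A → ℝ) (s' : S) : ℝ :=
  ∑ a', (π s').real {a'} * Q (s', a')

/-- The difference function `(s, a, s') ↦ ∑_{a'} π(a' | s') Q(s', a') - Q(s, a)` of `Q`. -/
def valueDiff [Fintype A] (π : Kernel S A) (Q : S × A → ℝ) (z : (S × A) × S) : ℝ :=
  policyMean π Q z.2 - Q z.1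

/-- `Q` is the relative value function `Q^{π, β}`: for every `(s, a)`, `Q (s, a)` is the limit of
`(1 / t*) ∑_{t = 1}^{t*} E_π[∑_{k = 1}^{t} (β - (β - R(S_k))₊ / (1 - c) - M(β, π)) | S_1 = s, A_1 = a]`
as `t* → ∞`.  The conditional law of `(S_{k + 1}, A_{k + 1})` is the `k`-th power of the
state-action kernel, evaluated at `(s, a)`. -/
def IsRelativeValue (P : Kernel (S × A) S) (π : Kernel S A) (c : ℝ) (R : S → ℝ) (d : Measure S)
    (β : ℝ) (Q : S × A → ℝ) : Prop :=
  ∀ x, Tendsto (fun τ : ℕ => (1 / (τ : ℝ)) * ∑ t ∈ Finset.Icc 1 τ, ∑ k ∈ Finset.range t,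
      ∫ y, (modReward c R β y.1 - objective c R d β) ∂((pairKernel P π ^ k) x))
    atTop (𝓝 (Q x))

/-- The ratio function `ω^π = d^π(s) π(a | s) / d^D(s, a)`: the density of `d^π ⊗ π` with respect
to the law `ρ` of a state-action pair in the data. -/
def ratio (ρ : Measure (S × A)) (d : Measure S) (π : Kernel S A) (x : S × A) : ℝ :=
  ((d ⊗ₘ π).rnDeriv ρ x).toReal

end Population

/-! ### The data -/

section Data

variable {Ω E S A : Type*} [MeasurableSpace Ω] [MeasurableSpace E] [MeasurableSpace S]
  [MeasurableSpace A]

/-- `Y` is a time-homogeneous Markov chain with initial law `ρ` and transition kernel `K`: given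
the history up to time `t`, the law of `Y (t + 1)` is `K (Y t)`. -/
def IsMarkovChain (Pr : Measure Ω) (K : Kernel E E) (ρ : Measure E) (Y : ℕ → Ω → E) : Prop :=
  (∀ t, Measurable (Y t)) ∧ Pr.map (Y 0) = ρ ∧
  ∀ t : ℕ, Pr.map (fun ω => ((fun i : Set.Iic t => Y i ω), Y (t + 1) ω)) =
    Pr.map (fun ω => (fun i : Set.Iic t => Y i ω)) ⊗ₘ
      (K.comap (fun h : Set.Iic t → E => h ⟨t, le_refl t⟩) (measurable_pi_apply _))

/-- `Y` is exponentially β-mixing: for every lag `k ≥ 1` and every time `j`, the total variation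
distance between the joint law of the past `(Y t)_{t ≤ j}` and the future `(Y t)_{t ≥ j + k}` and
the product of their laws is at most `b₀ exp (- b₁ k)`. -/
def IsExpBetaMixing (Pr : Measure Ω) (Y : ℕ → Ω → E) (b₀ b₁ : ℝ) : Prop :=
  ∀ k j : ℕ, 1 ≤ k → ∀ C : Set ((Set.Iic j → E) × (Set.Ici (j + k) → E)), MeasurableSet C →
    |(Pr.map (fun ω => ((fun i : Set.Iic j => Y i ω), fun i : Set.Ici (j + k) => Y i ω))).real C -
      ((Pr.map (fun ω => fun i : Set.Iic j => Y i ω)).prod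
        (Pr.map (fun ω => fun i : Set.Ici (j + k) => Y i ω))).real C| ≤ b₀ * Real.exp (-b₁ * k)

/-- The transition tuple `Z_t = (S_t, A_t, S_{t + 1})` of trajectory `i` at time `t`. -/
def transition (X : ℕ → ℕ → Ω → S × A) (ω : Ω) (i t : ℕ) : (S × A) × S :=
  (X i t ω, (X i (t + 1) ω).1)

/-- The sample average `(1 / n) ∑_{i < n} (1 / T) ∑_{t < T} f(Z_t^i)` over `n` trajectories of
length `T`. -/
def sampleMean (n T : ℕ) (Z : ℕ → ℕ → (S × A) × S) (f : (S × A) × S → ℝ) : ℝ :=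
  (n : ℝ)⁻¹ * ∑ i ∈ Finset.range n, (T : ℝ)⁻¹ * ∑ t ∈ Finset.range T, f (Z i t)

end Data

/-! ### The estimators

In this section `E` is a sample average, that is, the map `f ↦ (1 / N) ∑_{i, t} f(Z_t^i)`. -/

section Estimators

variable {S A : Type*} [MeasurableSpace S] [MeasurableSpace A] [Fintype A]

/-- The temporal difference error `δ^{π, β}(Z; η, Q)`. -/
def tdError (π : Kernel S A) (c : ℝ) (R : S → ℝ) (β η : ℝ) (Q : S × A → ℝ) (z : (S × A) × S) : ℝ :=
  modReward c R β z.1.1 + policyMean π Q z.2 - Q z.1 - η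

/-- The temporal difference `Δ^π(Z; H) = 1 - H(S, A) + ∑_{a'} π(a' | S') H(S', a')`. -/
def ratioTdError (π : Kernel S A) (H : S × A → ℝ) (z : (S × A) × S) : ℝ :=
  1 - H z.1 + policyMean π H z.2

/-- `g` minimizes the penalized least squares criterion `E[(y(Z) - g(S, A))²] + μ J(g)²` over the
class `G`. -/
def IsPenalizedFit (E : ((S × A) × S → ℝ) → ℝ) (G : Set (S × A → ℝ)) (J : (S × A → ℝ) → ℝ≥0)
    (μ : ℝ) (y : (S × A) × S → ℝ) (g : S × A → ℝ) : Prop :=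
  g ∈ G ∧ ∀ g' ∈ G, E (fun z => (y z - g z.1) ^ 2) + μ * (J g : ℝ) ^ 2 ≤
    E (fun z => (y z - g' z.1) ^ 2) + μ * (J g' : ℝ) ^ 2

/-- `Qh` is the coupled estimator of the (shifted) relative value function: for some `ηh`, the pair
`(ηh, Qh)` minimizes `E[ĝ(S, A; η, Q)²] + lam J₁(Q)²` over `ℝ × F`, where `ĝ(·; η, Q)` is the
penalized least squares fit of the temporal difference error `δ^{π, β}(Z; η, Q)` over `G`. -/
def IsValueEstimator (E : ((S × A) × S → ℝ) → ℝ) (π : Kernel S A) (c : ℝ) (R : S → ℝ)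
    (F G : Set (S × A → ℝ)) (J₁ J₂ : (S × A → ℝ) → ℝ≥0) (lam mu β : ℝ) (Qh : S × A → ℝ) : Prop :=
  ∃ (gh : ℝ → (S × A → ℝ) → (S × A → ℝ)) (ηh : ℝ),
    (∀ η, ∀ Q ∈ F, IsPenalizedFit E G J₂ mu (tdError π c R β η Q) (gh η Q)) ∧
    Qh ∈ F ∧
    ∀ η, ∀ Q ∈ F, E (fun z => gh ηh Qh z.1 ^ 2) + lam * (J₁ Qh : ℝ) ^ 2 ≤
      E (fun z => gh η Q z.1 ^ 2) + lam * (J₁ Q : ℝ) ^ 2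

/-- `eh` is the coupled estimator of the scaled ratio function: `eh = ĥ(·; Ĥ)`, where `Ĥ` minimizes
`E[ĥ(S, A; H)²] + lam J₁(H)²` over `F`, and `ĥ(·; H)` is the penalized least squares fit of the
temporal difference `Δ^π(Z; H)` over `G`. -/
def IsScaledRatioEstimator (E : ((S × A) × S → ℝ) → ℝ) (π : Kernel S A)
    (F G : Set (S × A → ℝ)) (J₁ J₂ : (S × A → ℝ) → ℝ≥0) (lam mu : ℝ) (eh : S × A → ℝ) : Prop :=
  ∃ (hh : (S × A → ℝ) → (S × A → ℝ)) (Hh : S × A → ℝ),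
    (∀ H ∈ F, IsPenalizedFit E G J₂ mu (ratioTdError π H) (hh H)) ∧
    Hh ∈ F ∧
    (∀ H ∈ F, E (fun z => hh Hh z.1 ^ 2) + lam * (J₁ Hh : ℝ) ^ 2 ≤
      E (fun z => hh H z.1 ^ 2) + lam * (J₁ H : ℝ) ^ 2) ∧
    eh = hh Hh

/-- The estimator of the ratio function: `eh` divided by its sample average. -/
def ratioEstimator (E : ((S × A) × S → ℝ) → ℝ) (eh : S × A → ℝ) (x : S × A) : ℝ :=
  eh x / E (fun z => eh z.1)

/-- The plug-in estimator
`E[w(S, A) (β - (β - R(S))₊ / (1 - c) + U(S, A, S'))] / E[w(S, A)]` of `M(β, π)`. -/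
def objectiveEstimator (E : ((S × A) × S → ℝ) → ℝ) (c : ℝ) (R : S → ℝ) (β : ℝ) (w : S × A → ℝ)
    (U : (S × A) × S → ℝ) : ℝ :=
  E (fun z => w z.1 * (modReward c R β z.1.1 + U z)) / E (fun z => w z.1)

/-- A class of measurable functions bounded by `B` whose subclasses `{f ∈ F : J(f) ≤ M}` have
logarithmic covering numbers in the sup norm of order `(M / ε) ^ (2 α)`. -/
structure IsFunctionClass (F : Set (S × A → ℝ)) (J : (S × A → ℝ) → ℝ≥0) (B C α : ℝ) : Prop where
  measurable : ∀ f ∈ F, Measurable f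
  bounded : ∀ f ∈ F, ∀ x, |f x| ≤ B
  entropy : ∀ ε > 0, ∀ M > 0, ∃ s : Finset (S × A → ℝ),
    Real.log (s.card : ℝ) ≤ C * (M / ε) ^ (2 * α) ∧
    ∀ f ∈ F, (J f : ℝ) ≤ M → ∃ g ∈ s, ∀ x, |f x - g x| ≤ ε

/-- The tuning rate `(log N) ^ ((2 + α) / (1 + α)) N ^ (-1 / (1 + α))`. -/
def tuningRate (α : ℝ) (N : ℕ) : ℝ :=
  Real.log (N : ℝ) ^ ((2 + α) / (1 + α)) * (N : ℝ) ^ (-1 / (1 + α))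

/-- The tuning parameters `lam k` are at least of the order of the tuning rate at `N k`. -/
def HasTuningRate (α : ℝ) (N : ℕ → ℕ) (lam : ℕ → ℝ) : Prop :=
  ∃ κ > 0, ∀ᶠ k in atTop, κ * tuningRate α (N k) ≤ lam k

end Estimators

end AvgMDP

end

/-! Write h_β = r_β − M(β,π). The normalized weights have sample average exactly one, so M(β,π) can
be moved inside the average: the estimation error is (P_N ê)⁻¹ P_N[ê (h_β + Û)], by
`objectiveEstimator_sub_objective`. It remains to replace P_N by the expectation, uniformly, and to
bound that expectation.

The expectation is doubly robust. With weights ω^π it vanishes for every bounded Q: reweighting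
turns the data law into d^π ⊗ π, which is invariant for the target chain and gives h_β mean zero
(`integral_weightedTd_ratio`). With Q = Q^{π,β} it vanishes for all bounded weights, by the Bellman
equation (`integral_weightedTd_relativeValue`). Since Q^{π,β} is only a pointwise limit and may be
unbounded, that equation is reached through bounded Cesàro sums, which solve it up to an average of
the iterated means of h_β. The mean-square contraction makes the norms of these means summable,
which dominates the limit and kills the remainder. By linearity the expectation is then at most a
constant times the L² error of the nuisance whose limit is correct.

The replacement is a uniform law of large numbers (`tendsto_measure_deviation`). Comparing the
estimators with fixed competitors bounds their penalties by a deterministic M with M^{2α} =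
O(N^{1/2}), so the relevant classes have log-covering numbers O(N^{1/2}). Transitions about N^{1/4}
apart are independent up to a total variation error which, summed over the sample, is of order N
exp(−b₁ N^{1/4}); Hoeffding's exponent for the resulting blocks is of order N^{3/4}, which beats the
entropy. All real β are covered by a finite net because h_β depends on β only through its projection
onto [−R_max, R_max].

For the supremum, the error bound is uniform in β: automatically if the weights are right, and
through the uniform convergence of Û otherwise. Uniform closeness to a function that attains its
maximum gives closeness of the suprema. -/

noncomputable section

namespace AvgMDP

/-! ### Total variation bounds -/

/-- `μ C ≤ ν C + δ` for all measurable sets `C`. For probability measures, this says that the total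
variation distance of `μ` and `ν` is at most `δ`. -/
def TVLe {α : Type*} [MeasurableSpace α] (μ ν : Measure α) (δ : ℝ≥0∞) : Prop :=
  ∀ C, MeasurableSet C → μ C ≤ ν C + δ

namespace TVLe

variable {α β : Type*} [MeasurableSpace α] [MeasurableSpace β]

lemma of_eq {μ ν : Measure α} (h : μ = ν) : TVLe μ ν 0 := fun C _ => by simp [h]

lemma trans {μ ν σ : Measure α} {δ ε : ℝ≥0∞} (h : TVLe μ ν δ) (h' : TVLe ν σ ε) :
    TVLe μ σ (δ + ε) := fun C hC =>
  calc μ C ≤ ν C + δ := h C hC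
    _ ≤ σ C + ε + δ := by gcongr; exact h' C hC
    _ = _ := by ring

lemma map {μ ν : Measure α} {δ : ℝ≥0∞} (h : TVLe μ ν δ) {f : α → β} (hf : Measurable f) :
    TVLe (μ.map f) (ν.map f) δ := fun C hC => by
  rw [Measure.map_apply hf hC, Measure.map_apply hf hC]
  exact h _ (hf hC)

lemma prod_right {μ ν : Measure α} [SFinite μ] [SFinite ν] {δ : ℝ≥0∞} (h : TVLe μ ν δ)
    (σ : Measure β) [IsProbabilityMeasure σ] : TVLe (μ.prod σ) (ν.prod σ) δ := fun C hC => by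
  rw [Measure.prod_apply_symm hC, Measure.prod_apply_symm hC]
  calc ∫⁻ y, μ ((fun x => (x, y)) ⁻¹' C) ∂σ
      ≤ ∫⁻ y, (ν ((fun x => (x, y)) ⁻¹' C) + δ) ∂σ :=
        lintegral_mono fun y => h _ (measurable_prodMk_right hC)
    _ = _ := by rw [lintegral_add_right _ measurable_const]; simp

lemma prod_left {μ ν : Measure β} [SFinite μ] [SFinite ν] {δ : ℝ≥0∞} (h : TVLe μ ν δ)
    (σ : Measure α) [IsProbabilityMeasure σ] : TVLe (σ.prod μ) (σ.prod ν) δ := fun C hC => by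
  rw [Measure.prod_apply hC, Measure.prod_apply hC]
  calc ∫⁻ x, μ (Prod.mk x ⁻¹' C) ∂σ
      ≤ ∫⁻ x, (ν (Prod.mk x ⁻¹' C) + δ) ∂σ :=
        lintegral_mono fun y => h _ (measurable_prodMk_left hC)
    _ = _ := by rw [lintegral_add_right _ measurable_const]; simp

/-- Replacing the factors one at a time costs δ each, because a common probability factor does not
increase the distance. -/
lemma pi : ∀ {n : ℕ} {μ ν : Fin n → Measure α} [∀ i, IsProbabilityMeasure (μ i)]
    [∀ i, IsProbabilityMeasure (ν i)] {δ : ℝ≥0∞}, (∀ i, TVLe (μ i) (ν i) δ) →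
    TVLe (Measure.pi μ) (Measure.pi ν) (n * δ)
  | 0, μ, ν, _, _, δ, h => by
    intro C hC
    rw [show μ = ν from Subsingleton.elim _ _]
    simp
  | n + 1, μ, ν, _, _, δ, h => by
    have key : ∀ (μ : Fin (n + 1) → Measure α) [∀ i, IsProbabilityMeasure (μ i)],
        Measure.pi μ = ((μ 0).prod (Measure.pi fun j => μ ((0 : Fin (n + 1)).succAbove j))).map
          (MeasurableEquiv.piFinSuccAbove (fun _ => α) 0).symm := fun μ _ =>
      ((measurePreserving_piFinSuccAbove μ 0).symm).map_eq.symm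
    rw [key μ, key ν]
    have h1 : TVLe (Measure.pi fun j => μ ((0 : Fin (n + 1)).succAbove j))
        (Measure.pi fun j => ν ((0 : Fin (n + 1)).succAbove j)) (n * δ) := pi fun i => h _
    have h2 := ((h 0).prod_right (Measure.pi fun j => μ ((0 : Fin (n + 1)).succAbove j))).trans
      (h1.prod_left (ν 0))
    convert h2.map (MeasurableEquiv.piFinSuccAbove (fun _ => α) 0).symm.measurable using 1
    push_cast; ring

/-- If each term of a sequence is close to being independent of the previous ones with law `ν`,
then the sequence is close to being independent with law `ν`. -/
lemma pi_of_forall_succ {Ω : Type*} [MeasurableSpace Ω] {Pr : Measure Ω} [IsProbabilityMeasure Pr]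
    {ν : Measure α} [IsProbabilityMeasure ν] {V : ℕ → Ω → α} (hV : ∀ l, Measurable (V l))
    {δ : ℝ≥0∞} : ∀ {L : ℕ}, (∀ l < L, TVLe (Pr.map fun ω => ((fun i : Fin l => V i ω), V l ω))
      ((Pr.map fun ω (i : Fin l) => V i ω).prod ν) δ) →
    TVLe (Pr.map fun ω (i : Fin L) => V i ω) (Measure.pi fun _ => ν) (L * δ)
  | 0, h => by
    intro C hC
    have : IsProbabilityMeasure (Pr.map fun ω (i : Fin 0) => V i ω) :=
      Measure.isProbabilityMeasure_map (by fun_prop)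
    rcases Set.eq_empty_or_nonempty C with rfl | ⟨x, hx⟩
    · simp
    · have : C = Set.univ := Set.eq_univ_of_forall fun y => (Subsingleton.elim x y) ▸ hx
      simp [this]
  | L + 1, h => by
    have : IsProbabilityMeasure (Pr.map fun ω (i : Fin L) => V i ω) :=
      Measure.isProbabilityMeasure_map (by fun_prop)
    have h1 := pi_of_forall_succ hV (L := L) fun l hl => h l (by omega)
    have h2 := (h L (by omega)).trans (h1.prod_right ν)
    let e : (Fin L → α) × α → (Fin (L + 1) → α) := fun p =>
      (MeasurableEquiv.piFinSuccAbove (fun _ => α) (Fin.last L)).symm (p.2, p.1)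
    have he : Measurable e :=
      (MeasurableEquiv.piFinSuccAbove (fun _ => α) (Fin.last L)).symm.measurable.comp
        (by fun_prop)
    have h3 := h2.map he
    have e1 : (Pr.map fun ω => ((fun i : Fin L => V i ω), V L ω)).map e
        = Pr.map fun ω (i : Fin (L + 1)) => V i ω := by
      rw [Measure.map_map he (by fun_prop)]
      congr 1
      funext ω i
      simp only [Function.comp, e, MeasurableEquiv.piFinSuccAbove_symm_apply]
      refine Fin.lastCases ?_ (fun j => ?_) i
      · simp [Fin.insertNthEquiv]
      · simp [Fin.insertNthEquiv]
    have e2 : ((Measure.pi fun _ : Fin L => ν).prod ν).map e = Measure.pi fun _ => ν := by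
      rw [show e = (MeasurableEquiv.piFinSuccAbove (fun _ => α) (Fin.last L)).symm ∘ Prod.swap
        from rfl, ← Measure.map_map (MeasurableEquiv.measurable _) measurable_swap,
        Measure.prod_swap]
      exact ((measurePreserving_piFinSuccAbove (fun _ => ν) (Fin.last L)).symm).map_eq
    rw [e1, e2] at h3
    convert h3 using 1
    push_cast; ring

end TVLe

/-! ### Hoeffding's inequality for arrays -/

/-- Sub-Gaussian parameters add over independent coordinates. This is applied twice below: over the
times within a trajectory, then over trajectories. -/
lemma hasSubgaussianMGF_sum_pi {α : Type*} [MeasurableSpace α] {n : ℕ} {ν : Measure α}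
    [IsProbabilityMeasure ν] {g : α → ℝ} (hg : Measurable g) {c : ℝ≥0}
    (h : HasSubgaussianMGF g c ν) :
    HasSubgaussianMGF (fun x : Fin n → α => ∑ i, g (x i)) (n * c) (Measure.pi fun _ => ν) := by
  have h1 : ∀ i : Fin n, HasSubgaussianMGF (fun x : Fin n → α => g (x i)) c
      (Measure.pi fun _ => ν) := fun i => by
    have := (measurePreserving_eval (fun _ : Fin n => ν) i)
    refine HasSubgaussianMGF.of_map this.measurable.aemeasurable (X := g) ?_
    rwa [this.map_eq]
  have := HasSubgaussianMGF.sum_of_iIndepFun (s := Finset.univ) (c := fun _ => c)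
    (iIndepFun_pi (μ := fun _ : Fin n => ν) (X := fun _ => g) fun _ => hg.aemeasurable)
    (fun i _ => h1 i)
  simpa using this

lemma measure_pi_pi_abs_sum_ge_le {α : Type*} [MeasurableSpace α] (n m : ℕ) (ν : Measure α)
    [IsProbabilityMeasure ν] {f : α → ℝ} (hf : Measurable f) {B : ℝ}
    (hfB : ∀ x, |f x| ≤ B) {s : ℝ} (hs : 0 ≤ s) :
    (Measure.pi fun _ : Fin n => Measure.pi fun _ : Fin m => ν)
      {x | s ≤ |∑ i, ∑ j, (f (x i j) - ∫ y, f y ∂ν)|} ≤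
    ENNReal.ofReal (2 * Real.exp (-s ^ 2 / (2 * (n * m * B ^ 2)))) := by
  have h0 := hasSubgaussianMGF_of_mem_Icc (μ := ν) hf.aemeasurable (a := -B) (b := B)
    (ae_of_all _ fun x => abs_le.1 (hfB x))
  -- Hoeffding's lemma on [−B, B] gives the parameter (2B / 2)² = B².
  have hc : (((‖B - -B‖₊ / 2) ^ 2 : ℝ≥0) : ℝ) = B ^ 2 := by
    push_cast
    rw [Real.norm_eq_abs, div_pow, sq_abs]; ring
  have h1 := hasSubgaussianMGF_sum_pi (n := n) (by fun_prop)
    (hasSubgaussianMGF_sum_pi (n := m) (by fun_prop) h0)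
  have h2 := h1.measure_ge_le hs
  have h3 := h1.neg.measure_ge_le hs
  simp only [NNReal.coe_mul, NNReal.coe_natCast, hc, ← mul_assoc] at h2 h3
  rw [← ofReal_measureReal]
  apply ENNReal.ofReal_le_ofReal
  have hsub : {x : Fin n → Fin m → α | s ≤ |∑ i, ∑ j, (f (x i j) - ∫ y, f y ∂ν)|} ⊆
      {x | s ≤ ∑ i, ∑ j, (f (x i j) - ∫ y, f y ∂ν)} ∪
      {x | s ≤ (-fun x : Fin n → Fin m → α => ∑ i, ∑ j, (f (x i j) - ∫ y, f y ∂ν)) x} := by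
    intro x hx
    simpa [le_abs] using hx
  refine (measureReal_mono hsub).trans ((measureReal_union_le _ _).trans ?_)
  simp only [← mul_assoc]
  linarith

lemma TVLe.mono {α : Type*} [MeasurableSpace α] {μ ν : Measure α} {δ ε : ℝ≥0∞} (h : TVLe μ ν δ)
    (hδ : δ ≤ ε) : TVLe μ ν ε := fun C hC => (h C hC).trans (by gcongr)

/-! ### The laws of the data -/

instance isMarkovKernel_pairKernel {S A : Type*} [MeasurableSpace S] [MeasurableSpace A]
    (P : Kernel (S × A) S) [IsMarkovKernel P] (π : Kernel S A) [IsMarkovKernel π] :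
    IsMarkovKernel (pairKernel P π) := by unfold pairKernel; infer_instance

lemma map_compProd_comap {α β γ : Type*} [MeasurableSpace α] [MeasurableSpace β]
    [MeasurableSpace γ] (μ : Measure α) [SFinite μ] (K : Kernel β γ) [IsSFiniteKernel K]
    {g : α → β} (hg : Measurable g) :
    (μ ⊗ₘ K.comap g hg).map (Prod.map g id) = (μ.map g) ⊗ₘ K := by
  ext C hC
  have hm : Measurable (Prod.map g (id : γ → γ)) := by fun_prop
  rw [Measure.map_apply hm hC, Measure.compProd_apply (hm hC), Measure.compProd_apply hC,
    lintegral_map (Kernel.measurable_kernel_prodMk_left hC) hg]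
  rfl

namespace IsMarkovChain

variable {Ω E : Type*} [MeasurableSpace Ω] [MeasurableSpace E] {Pr : Measure Ω}
  [IsProbabilityMeasure Pr] {K : Kernel E E} [IsMarkovKernel K] {ρ : Measure E}
  {Y : ℕ → Ω → E}

lemma map_pair (h : IsMarkovChain Pr K ρ Y) (t : ℕ) :
    Pr.map (fun ω => (Y t ω, Y (t + 1) ω)) = Pr.map (Y t) ⊗ₘ K := by
  obtain ⟨hm, -, h2⟩ := h
  have hg : Measurable fun h : Set.Iic t → E => h ⟨t, le_refl t⟩ := measurable_pi_apply _
  have hp : Measurable fun ω => (fun i : Set.Iic t => Y i ω) := by fun_prop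
  have := congrArg (Measure.map (Prod.map (fun h : Set.Iic t → E => h ⟨t, le_refl t⟩) id)) (h2 t)
  rw [map_compProd_comap _ _ hg, Measure.map_map (by fun_prop) (by fun_prop),
    Measure.map_map hg hp] at this
  exact this

lemma map_eq (h : IsMarkovChain Pr K ρ Y) (hρ : Kernel.Invariant K ρ) (t : ℕ) :
    Pr.map (Y t) = ρ := by
  induction t with
  | zero => exact h.2.1
  | succ t ih =>
    have := congrArg Measure.snd (h.map_pair t)
    rw [Measure.snd_compProd, ih, hρ.def, Measure.snd, Measure.map_map measurable_snd
      ((h.1 t).prodMk (h.1 (t + 1)))] at this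
    exact this

end IsMarkovChain

lemma pairKernel_map_fst {S A : Type*} [MeasurableSpace S] [MeasurableSpace A]
    (P : Kernel (S × A) S) [IsMarkovKernel P] (π : Kernel S A) [IsMarkovKernel π] :
    (pairKernel P π).map Prod.fst = P := by
  rw [pairKernel, Kernel.map_comp, ← Kernel.fst_eq, Kernel.fst_prod, Kernel.id_comp]

lemma compProd_map_prodMap {α β γ : Type*} [MeasurableSpace α] [MeasurableSpace β]
    [MeasurableSpace γ] (μ : Measure α) [SFinite μ] (K : Kernel α β) [IsSFiniteKernel K]
    {g : β → γ} (hg : Measurable g) :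
    (μ ⊗ₘ K).map (Prod.map id g) = μ ⊗ₘ (K.map g) := by
  ext C hC
  have hm : Measurable (Prod.map (id : α → α) g) := by fun_prop
  rw [Measure.map_apply hm hC, Measure.compProd_apply (hm hC), Measure.compProd_apply hC]
  congr 1 with x
  rw [Kernel.map_apply' _ hg _ (measurable_prodMk_left hC)]
  rfl

section Sampling

variable {S A Ω : Type*} [MeasurableSpace S] [MeasurableSpace A] [MeasurableSpace Ω]
  {P : Kernel (S × A) S} [IsMarkovKernel P] {πb : Kernel S A} [IsMarkovKernel πb]
  {ρ : Measure (S × A)} {Pr : Measure Ω} [IsProbabilityMeasure Pr]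

/-- Forgetting the next action turns the pair kernel into `P`, so the behavior policy enters the law
of a transition only through `ρ`. -/
lemma map_transition {Y : ℕ → Ω → S × A} (h : IsMarkovChain Pr (pairKernel P πb) ρ Y)
    (hρ : Kernel.Invariant (pairKernel P πb) ρ) (t : ℕ) :
    Pr.map (fun ω => (Y t ω, (Y (t + 1) ω).1)) = ρ ⊗ₘ P := by
  have h1 := congrArg (Measure.map (Prod.map id Prod.fst)) (h.map_pair t)
  rw [compProd_map_prodMap _ _ measurable_fst, pairKernel_map_fst, h.map_eq hρ t,
    Measure.map_map (by fun_prop) ((h.1 t).prodMk (h.1 (t + 1)))] at h1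
  exact h1

lemma IsExpBetaMixing.tvLe {E : Type*} [MeasurableSpace E] {Y : ℕ → Ω → E}
    (hY : ∀ t, Measurable (Y t)) {b₀ b₁ : ℝ} (hb₀ : 0 ≤ b₀)
    (h : IsExpBetaMixing Pr Y b₀ b₁) {k : ℕ} (hk : 1 ≤ k) (j : ℕ) :
    TVLe (Pr.map (fun ω => ((fun i : Set.Iic j => Y i ω), fun i : Set.Ici (j + k) => Y i ω)))
      ((Pr.map (fun ω => fun i : Set.Iic j => Y i ω)).prod
        (Pr.map (fun ω => fun i : Set.Ici (j + k) => Y i ω)))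
      (ENNReal.ofReal (b₀ * Real.exp (-b₁ * k))) := fun C hC => by
  have : IsProbabilityMeasure (Pr.map (fun ω => ((fun i : Set.Iic j => Y i ω),
      fun i : Set.Ici (j + k) => Y i ω))) := Measure.isProbabilityMeasure_map (by fun_prop)
  have : IsProbabilityMeasure (Pr.map (fun ω => fun i : Set.Iic j => Y i ω)) :=
    Measure.isProbabilityMeasure_map (by fun_prop)
  have : IsProbabilityMeasure (Pr.map (fun ω => fun i : Set.Ici (j + k) => Y i ω)) :=
    Measure.isProbabilityMeasure_map (by fun_prop)
  have h1 := (abs_le.1 (h k j hk C hC)).2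
  rw [← ofReal_measureReal, ← ofReal_measureReal, ← ENNReal.ofReal_add measureReal_nonneg
    (by positivity)]
  exact ENNReal.ofReal_le_ofReal (by linarith)

variable [IsProbabilityMeasure ρ]

/-- Transitions of a trajectory at times that are `a` apart are close to being independent. -/
lemma tvLe_spaced_transitions {Y : ℕ → Ω → S × A} (h : IsMarkovChain Pr (pairKernel P πb) ρ Y)
    (hρ : Kernel.Invariant (pairKernel P πb) ρ) {b₀ b₁ : ℝ} (hb₀ : 0 ≤ b₀)
    (hmix : IsExpBetaMixing Pr Y b₀ b₁) {a m : ℕ} (r : ℕ) {δ : ℝ≥0∞}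
    (hδ : m ≤ 1 ∨ (2 ≤ a ∧ ENNReal.ofReal (b₀ * Real.exp (-b₁ * (a - 1 : ℕ))) ≤ δ)) :
    TVLe (Pr.map fun ω (l : Fin m) => (Y (r + l * a) ω, (Y (r + l * a + 1) ω).1))
      (Measure.pi fun _ => ρ ⊗ₘ P) (m * δ) := by
  have hY := h.1
  refine TVLe.pi_of_forall_succ (V := fun l ω => (Y (r + l * a) ω, (Y (r + l * a + 1) ω).1))
    (fun l => by fun_prop) fun l hl => ?_
  -- The first transition of a block has no predecessor and exactly the right law. Hence a block of
  -- length at most one needs no mixing, which is the alternative `m ≤ 1`.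
  rcases l with _ | l
  · refine TVLe.mono (TVLe.of_eq ?_) zero_le
    have hc : ∀ ω, (fun i : Fin 0 => (Y (r + i * a) ω, (Y (r + i * a + 1) ω).1)) =
        (default : Fin 0 → (S × A) × S) := fun ω => Subsingleton.elim _ _
    have hd : Pr.map (fun ω (i : Fin 0) => (Y (r + i * a) ω, (Y (r + i * a + 1) ω).1)) =
        Measure.dirac default := by
      rw [funext hc, Measure.map_const, measure_univ, one_smul]
    rw [hd, Measure.dirac_prod, ← map_transition h hρ r,
      Measure.map_map (by fun_prop) (by fun_prop)]
    congr 1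
    funext ω
    simp only [Function.comp, zero_mul, add_zero, Prod.mk.injEq, and_true]
    exact hc ω
  · obtain ⟨ha, hδ⟩ := hδ.resolve_left (by omega)
    refine TVLe.mono ?_ hδ
    -- A transition at time t also involves time t + 1, so transitions `a` apart are separated by a
    -- gap of only `a - 1`; this is positive because 2 ≤ a.
    have hjk : r + l * a + 1 + (a - 1) = r + (l + 1) * a := by
      rw [add_mul]; omega
    have hle : ∀ i : Fin (l + 1), r + i * a + 1 ≤ r + l * a + 1 := fun i => by
      have : (i : ℕ) * a ≤ l * a := Nat.mul_le_mul_right _ (by omega)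
      omega
    have h1 := hmix.tvLe hY hb₀ (k := a - 1) (by omega) (r + l * a + 1)
    let p : (Set.Iic (r + l * a + 1) → S × A) → (Fin (l + 1) → (S × A) × S) := fun h i =>
      (h ⟨r + i * a, by have := hle i; simp only [Set.mem_Iic]; omega⟩, (h ⟨r + i * a + 1, hle i⟩).1)
    let q : (Set.Ici (r + l * a + 1 + (a - 1)) → S × A) → (S × A) × S := fun h =>
      (h ⟨r + (l + 1) * a, hjk.le⟩,
        (h ⟨r + (l + 1) * a + 1, by simp only [Set.mem_Ici]; omega⟩).1)
    have hp : Measurable p := by fun_prop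
    have hq : Measurable q := by fun_prop
    have h2 := h1.map (hp.prodMap hq)
    have : IsProbabilityMeasure (Pr.map (fun ω => fun i : Set.Iic (r + l * a + 1) => Y i ω)) :=
      Measure.isProbabilityMeasure_map (by fun_prop)
    have : IsProbabilityMeasure (Pr.map
        (fun ω => fun i : Set.Ici (r + l * a + 1 + (a - 1)) => Y i ω)) :=
      Measure.isProbabilityMeasure_map (by fun_prop)
    rw [← Measure.map_prod_map _ _ hp hq, Measure.map_map (hp.prodMap hq) (by fun_prop),
      Measure.map_map hp (by fun_prop), Measure.map_map hq (by fun_prop)] at h2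
    have h3 : Pr.map (q ∘ fun ω => fun i : Set.Ici (r + l * a + 1 + (a - 1)) => Y i ω)
        = ρ ⊗ₘ P := map_transition h hρ (r + (l + 1) * a)
    rw [h3] at h2
    exact h2

variable {X : ℕ → ℕ → Ω → S × A}

/-- The array of the transitions at times that are `a` apart of `n` independent trajectories is
close to being independent. -/
lemma tvLe_spaced_array (hchain : ∀ i, IsMarkovChain Pr (pairKernel P πb) ρ (X i))
    (hindep : iIndepFun (fun i ω t => X i t ω) Pr) (hρ : Kernel.Invariant (pairKernel P πb) ρ)
    {b₀ b₁ : ℝ} (hb₀ : 0 ≤ b₀) (hmix : ∀ i, IsExpBetaMixing Pr (X i) b₀ b₁) (n : ℕ) {a m : ℕ}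
    (r : ℕ) {δ : ℝ≥0∞}
    (hδ : m ≤ 1 ∨ (2 ≤ a ∧ ENNReal.ofReal (b₀ * Real.exp (-b₁ * (a - 1 : ℕ))) ≤ δ)) :
    TVLe (Pr.map fun ω (i : Fin n) (l : Fin m) => transition X ω i (r + l * a))
      (Measure.pi fun _ => Measure.pi fun _ => ρ ⊗ₘ P) (n * (m * δ)) := by
  have hX : ∀ i t, Measurable (X i t) := fun i => (hchain i).1
  have hm : ∀ i : Fin n, Measurable fun ω (l : Fin m) => transition X ω i (r + l * a) := fun i => by
    unfold transition; fun_prop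
  have h1 : iIndepFun (fun (i : Fin n) ω (l : Fin m) => transition X ω i (r + l * a)) Pr := by
    have h2 := (hindep.precomp (g := fun i : Fin n => (i : ℕ)) Fin.val_injective).comp
      (fun _ x (l : Fin m) => (x (r + l * a), (x (r + l * a + 1)).1)) (fun i => by fun_prop)
    exact h2
  rw [(iIndepFun_iff_map_fun_eq_pi_map fun i => (hm i).aemeasurable).1 h1]
  have : ∀ i : Fin n,
      IsProbabilityMeasure (Pr.map fun ω (l : Fin m) => transition X ω i (r + l * a)) :=
    fun i => Measure.isProbabilityMeasure_map (hm i).aemeasurable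
  exact TVLe.pi fun i => tvLe_spaced_transitions (hchain i) hρ hb₀ (hmix i) r hδ

/-- A deviation bound for the sums of a finite family of functions over transitions that are `a`
apart. -/
lemma measure_exists_spaced_sum_le (hchain : ∀ i, IsMarkovChain Pr (pairKernel P πb) ρ (X i))
    (hindep : iIndepFun (fun i ω t => X i t ω) Pr) (hρ : Kernel.Invariant (pairKernel P πb) ρ)
    {b₀ b₁ : ℝ} (hb₀ : 0 ≤ b₀) (hmix : ∀ i, IsExpBetaMixing Pr (X i) b₀ b₁) (n : ℕ) {a m : ℕ}
    (r : ℕ) {δ : ℝ≥0∞}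
    (hδ : m ≤ 1 ∨ (2 ≤ a ∧ ENNReal.ofReal (b₀ * Real.exp (-b₁ * (a - 1 : ℕ))) ≤ δ))
    {H : Finset ((S × A) × S → ℝ)} {B : ℝ} (hH : ∀ f ∈ H, Measurable f)
    (hHB : ∀ f ∈ H, ∀ z, |f z| ≤ B) {s : ℝ} (hs : 0 ≤ s) :
    Pr {ω | ∃ f ∈ H, s ≤ |∑ i ∈ Finset.range n, ∑ l ∈ Finset.range m,
      (f (transition X ω i (r + l * a)) - ∫ z, f z ∂(ρ ⊗ₘ P))|} ≤
    H.card * ENNReal.ofReal (2 * Real.exp (-s ^ 2 / (2 * (n * m * B ^ 2)))) + n * (m * δ) := by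
  have hX : ∀ i t, Measurable (X i t) := fun i => (hchain i).1
  let C : Set (Fin n → Fin m → (S × A) × S) :=
    ⋃ f ∈ H, {x | s ≤ |∑ i, ∑ j, (f (x i j) - ∫ z, f z ∂(ρ ⊗ₘ P))|}
  have hC : MeasurableSet C := by
    refine Finset.measurableSet_biUnion _ fun f hf => ?_
    have := hH f hf
    exact measurableSet_le measurable_const (by fun_prop)
  have hm : Measurable fun ω (i : Fin n) (l : Fin m) => transition X ω i (r + l * a) := by
    unfold transition; fun_prop
  have h1 := tvLe_spaced_array hchain hindep hρ hb₀ hmix n r hδ C hC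
  rw [Measure.map_apply hm hC] at h1
  refine le_trans (measure_mono ?_) (h1.trans ?_)
  · rintro ω ⟨f, hf, h⟩
    simp only [Set.mem_preimage, C, Set.mem_iUnion]
    refine ⟨f, hf, ?_⟩
    simpa only [Set.mem_ofPred_eq, Finset.sum_range] using h
  · gcongr
    refine (measure_biUnion_finset_le _ _).trans ?_
    refine (Finset.sum_le_sum fun f hf =>
      measure_pi_pi_abs_sum_ge_le n m (ρ ⊗ₘ P) (hH f hf) (hHB f hf) hs).trans ?_
    simp

end Sampling

/-! ### Deviations of the sample average -/

/-- Euclidean division t = r + l a; the class of r < a contains ⌈(T − r) / a⌉ times below T. -/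
lemma sum_range_eq_sum_residues {M : Type*} [AddCommMonoid M] (g : ℕ → M) (T : ℕ) {a : ℕ}
    (ha : 0 < a) :
    ∑ t ∈ Finset.range T, g t =
      ∑ r ∈ Finset.range a, ∑ l ∈ Finset.range ((T + a - 1 - r) / a), g (r + l * a) := by
  rw [Finset.sum_sigma']
  refine Finset.sum_bij' (fun t _ => (⟨t % a, t / a⟩ : (_ : ℕ) × ℕ)) (fun x _ => x.1 + x.2 * a)
    ?_ ?_ ?_ ?_ ?_
  · intro t ht
    have h1 := Nat.mod_lt t ha
    have h2 := Nat.mod_add_div' t a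
    simp only [Finset.mem_range, Finset.mem_sigma] at ht ⊢
    refine ⟨h1, (Nat.le_div_iff_mul_le ha).2 ?_⟩
    rw [Nat.succ_mul]; omega
  · rintro ⟨r, l⟩ hx
    simp only [Finset.mem_range, Finset.mem_sigma] at hx ⊢
    have h1 := (Nat.le_div_iff_mul_le ha).1 (Nat.succ_le_of_lt hx.2)
    rw [Nat.succ_mul] at h1; omega
  · intro t _
    exact Nat.mod_add_div' t a
  · rintro ⟨r, l⟩ hx
    simp only [Finset.mem_range, Finset.mem_sigma] at hx
    have h1 : (r + l * a) % a = r := by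
      rw [Nat.add_mul_mod_self_right, Nat.mod_eq_of_lt hx.1]
    have h2 : (r + l * a) / a = l := by
      rw [Nat.add_mul_div_right _ _ ha, Nat.div_eq_of_lt hx.1, zero_add]
    simp only [h1, h2]
  · intro t _
    rw [Nat.mod_add_div' t a]

lemma sampleMean_sub_const {S A : Type*} {n T : ℕ} (hn : 0 < n) (hT : 0 < T)
    (Z : ℕ → ℕ → (S × A) × S) (f : (S × A) × S → ℝ) (u : ℝ) :
    sampleMean n T Z f - u =
      (n * T : ℝ)⁻¹ * ∑ i ∈ Finset.range n, ∑ t ∈ Finset.range T, (f (Z i t) - u) := by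
  have hn' : (n : ℝ) ≠ 0 := by positivity
  have hT' : (T : ℝ) ≠ 0 := by positivity
  simp only [sampleMean, Finset.sum_sub_distrib, ← Finset.mul_sum]
  simp only [Finset.sum_const, Finset.card_range, nsmul_eq_mul]
  field_simp

section Sampling

variable {S A Ω : Type*} [MeasurableSpace S] [MeasurableSpace A] [MeasurableSpace Ω]
  {P : Kernel (S × A) S} [IsMarkovKernel P] {πb : Kernel S A} [IsMarkovKernel πb]
  {ρ : Measure (S × A)} [IsProbabilityMeasure ρ] {Pr : Measure Ω} [IsProbabilityMeasure Pr]
  {X : ℕ → ℕ → Ω → S × A}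

/-- A deviation bound for the sample averages of a finite family of functions. -/
lemma measure_exists_sampleMean_le (hchain : ∀ i, IsMarkovChain Pr (pairKernel P πb) ρ (X i))
    (hindep : iIndepFun (fun i ω t => X i t ω) Pr) (hρ : Kernel.Invariant (pairKernel P πb) ρ)
    {b₀ b₁ : ℝ} (hb₀ : 0 ≤ b₀) (hmix : ∀ i, IsExpBetaMixing Pr (X i) b₀ b₁) {n T a : ℕ}
    (hn : 0 < n) (hT : 0 < T) (ha : 2 ≤ a)
    {H : Finset ((S × A) × S → ℝ)} {B : ℝ} (hB : 0 < B) (hH : ∀ f ∈ H, Measurable f)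
    (hHB : ∀ f ∈ H, ∀ z, |f z| ≤ B) {ε : ℝ} (hε : 0 < ε) :
    Pr {ω | ∃ f ∈ H, ε ≤ |sampleMean n T (transition X ω) f - ∫ z, f z ∂(ρ ⊗ₘ P)|} ≤
    a * (H.card * ENNReal.ofReal (2 * Real.exp (-(ε ^ 2 * (n * T) / (4 * a * B ^ 2))))) +
      n * (T * ENNReal.ofReal (b₀ * Real.exp (-b₁ * (a - 1 : ℕ)))) := by
  set δ := ENNReal.ofReal (b₀ * Real.exp (-b₁ * (a - 1 : ℕ))) with hδ
  -- If T < a, spacing T is used instead: each residue class is then a single time and no mixing is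
  -- needed. In either case a' ≤ T, which keeps the block lengths below 2T / a'.
  set a' := min a T with ha'
  have ha0 : 0 < a' := by omega
  have ha0' : (0 : ℝ) < a' := by exact_mod_cast ha0
  have hn' : (0 : ℝ) < n := by exact_mod_cast hn
  have hT' : (0 : ℝ) < T := by exact_mod_cast hT
  have haa : a' ≤ a := min_le_left _ _
  have haT : a' ≤ T := min_le_right _ _
  set m : ℕ → ℕ := fun r => (T + a' - 1 - r) / a' with hm
  have hmpos : ∀ r < a', 0 < m r := fun r hr => Nat.div_pos (by omega) ha0
  have hmle : ∀ r, m r * a' ≤ 2 * T := fun r => (Nat.div_mul_le_self _ _).trans (by omega)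
  have hmsum : ∑ r ∈ Finset.range a', m r = T := by
    have := sum_range_eq_sum_residues (fun _ => (1 : ℕ)) T ha0
    simpa using this.symm
  have hcond : ∀ r, m r ≤ 1 ∨
      (2 ≤ a' ∧ ENNReal.ofReal (b₀ * Real.exp (-b₁ * (a' - 1 : ℕ))) ≤ δ) := fun r => by
    rcases le_total a T with h | h
    · right
      rw [ha', min_eq_left h]
      exact ⟨ha, le_rfl⟩
    · left
      have hT2 : a' = T := min_eq_right h
      refine Nat.lt_succ_iff.1 ((Nat.div_lt_iff_lt_mul ha0).2 ?_)
      rw [hT2]; omega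
  -- If the total deviation reaches ε n T, then one of the a' residue classes contributes at least
  -- its equal share.
  let s : ℝ := ε * (n * T) / a'
  have hs : 0 ≤ s := by positivity
  let D : ℕ → Set Ω := fun r => {ω | ∃ f ∈ H, s ≤ |∑ i ∈ Finset.range n, ∑ l ∈ Finset.range (m r),
      (f (transition X ω i (r + l * a')) - ∫ z, f z ∂(ρ ⊗ₘ P))|}
  have hsub : {ω | ∃ f ∈ H, ε ≤ |sampleMean n T (transition X ω) f - ∫ z, f z ∂(ρ ⊗ₘ P)|} ⊆
      ⋃ r ∈ Finset.range a', D r := by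
    rintro ω ⟨f, hf, h⟩
    by_contra hcon
    simp only [Set.mem_iUnion, not_exists] at hcon
    rw [sampleMean_sub_const hn hT, abs_mul, abs_of_pos (by positivity),
      Finset.sum_congr rfl fun i _ => sum_range_eq_sum_residues _ T ha0, Finset.sum_comm] at h
    have h2 : |∑ r ∈ Finset.range a', ∑ i ∈ Finset.range n, ∑ l ∈ Finset.range (m r),
        (f (transition X ω i (r + l * a')) - ∫ z, f z ∂(ρ ⊗ₘ P))| < ∑ r ∈ Finset.range a', s := by
      refine (Finset.abs_sum_le_sum_abs _ _).trans_lt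
        (Finset.sum_lt_sum_of_nonempty (by simpa using ha0.ne') fun r hr => ?_)
      have := hcon r hr
      simp only [D, Set.mem_ofPred_eq, not_exists, not_and, not_le] at this
      exact this f hf
    have h3 : ∑ r ∈ Finset.range a', s = ε * (n * T) := by
      simp only [Finset.sum_const, Finset.card_range, nsmul_eq_mul, s]
      field_simp
    rw [h3] at h2
    have h4 : ε < ε := by
      calc ε ≤ _ := h
        _ < (n * T : ℝ)⁻¹ * (ε * (n * T)) := by gcongr
        _ = ε := by field_simp
    exact lt_irrefl _ h4
  refine (measure_mono hsub).trans ((measure_biUnion_finset_le _ _).trans ?_)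
  have hD : ∀ r ∈ Finset.range a', Pr (D r) ≤
      H.card * ENNReal.ofReal (2 * Real.exp (-(ε ^ 2 * (n * T) / (4 * a * B ^ 2)))) +
        n * (m r * δ) := fun r hr => by
    have hr' := Finset.mem_range.1 hr
    refine (measure_exists_spaced_sum_le hchain hindep hρ hb₀ hmix n r (hcond r) hH hHB hs).trans ?_
    gcongr
    have hmp : (0 : ℝ) < m r := by exact_mod_cast hmpos r hr'
    have hml : (m r : ℝ) * a' ≤ 2 * T := by exact_mod_cast hmle r
    have haa' : (a' : ℝ) ≤ a := by exact_mod_cast haa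
    rw [neg_div, neg_le_neg_iff, div_le_div_iff₀ (by positivity) (by positivity)]
    simp only [s, div_pow]
    rw [div_mul_eq_mul_div, le_div_iff₀ (by positivity)]
    have h1 : (m r : ℝ) * a' * a' ≤ 2 * T * a := by gcongr
    calc ε ^ 2 * (n * T) * (2 * (n * m r * B ^ 2)) * a' ^ 2
        = (2 * ε ^ 2 * n ^ 2 * T * B ^ 2) * (m r * a' * a') := by ring
      _ ≤ (2 * ε ^ 2 * n ^ 2 * T * B ^ 2) * (2 * T * a) := by gcongr
      _ = _ := by ring
  refine (Finset.sum_le_sum hD).trans ?_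
  rw [Finset.sum_add_distrib, Finset.sum_const, Finset.card_range, nsmul_eq_mul,
    ← Finset.mul_sum, ← Finset.sum_mul, ← Nat.cast_sum, hmsum]
  gcongr

end Sampling

/-! ### Elementary bounds -/

lemma sampleMean_sub {S A : Type*} (n T : ℕ) (Z : ℕ → ℕ → (S × A) × S)
    (f g : (S × A) × S → ℝ) :
    sampleMean n T Z f - sampleMean n T Z g = sampleMean n T Z (fun z => f z - g z) := by
  simp only [sampleMean, Finset.sum_sub_distrib, mul_sub]

lemma sampleMean_const_mul {S A : Type*} (n T : ℕ) (Z : ℕ → ℕ → (S × A) × S)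
    (u : ℝ) (f : (S × A) × S → ℝ) :
    sampleMean n T Z (fun z => u * f z) = u * sampleMean n T Z f := by
  simp only [sampleMean, ← Finset.mul_sum]; ring

lemma sampleMean_nonneg {S A : Type*} {n T : ℕ} (Z : ℕ → ℕ → (S × A) × S)
    {f : (S × A) × S → ℝ} (hf : ∀ z, 0 ≤ f z) : 0 ≤ sampleMean n T Z f := by
  unfold sampleMean
  exact mul_nonneg (by positivity) (Finset.sum_nonneg fun i _ =>
    mul_nonneg (by positivity) (Finset.sum_nonneg fun t _ => hf _))

lemma abs_sampleMean_le {S A : Type*} {n T : ℕ} (hn : 0 < n) (hT : 0 < T)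
    (Z : ℕ → ℕ → (S × A) × S) {f : (S × A) × S → ℝ} {b : ℝ} (hf : ∀ z, |f z| ≤ b) :
    |sampleMean n T Z f| ≤ b := by
  have h := sampleMean_sub_const hn hT Z f 0
  simp only [sub_zero] at h
  rw [h, abs_mul, abs_of_pos (by positivity), inv_mul_le_iff₀ (by positivity)]
  refine (Finset.abs_sum_le_sum_abs _ _).trans ?_
  refine (Finset.sum_le_sum fun i _ => (Finset.abs_sum_le_sum_abs _ _).trans
    (Finset.sum_le_sum fun t _ => hf _)).trans ?_
  simp [mul_assoc]

lemma abs_integral_le_of_abs_le {α : Type*} [MeasurableSpace α] (μ : Measure α)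
    [IsProbabilityMeasure μ] {f : α → ℝ} {b : ℝ} (hf : ∀ x, |f x| ≤ b) : |∫ x, f x ∂μ| ≤ b := by
  have := norm_integral_le_of_norm_le_const (μ := μ) (f := f) (C := b) (ae_of_all _ hf)
  simpa using this

lemma integrable_of_abs_le {α : Type*} [MeasurableSpace α] {μ : Measure α} [IsFiniteMeasure μ]
    {f : α → ℝ} (hm : Measurable f) {b : ℝ} (hf : ∀ x, |f x| ≤ b) : Integrable f μ :=
  Integrable.of_bound hm.aestronglyMeasurable b (ae_of_all _ hf)

section Policy

variable {S A : Type*} [MeasurableSpace S] [MeasurableSpace A] [Fintype A]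
  {π : Kernel S A}

lemma policyMean_sub (Q Q' : S × A → ℝ) (s : S) :
    policyMean π Q s - policyMean π Q' s = policyMean π (fun x => Q x - Q' x) s := by
  simp only [policyMean, ← Finset.sum_sub_distrib, mul_sub]

lemma valueDiff_sub (Q Q' : S × A → ℝ) (z : (S × A) × S) :
    valueDiff π Q z - valueDiff π Q' z = valueDiff π (fun x => Q x - Q' x) z := by
  simp only [valueDiff, ← policyMean_sub]; ring

variable [MeasurableSingletonClass A]

lemma measurable_policyMean {Q : S × A → ℝ} (hQ : Measurable Q) : Measurable (policyMean π Q) := by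
  unfold policyMean
  refine Finset.measurable_sum _ fun a _ => Measurable.mul ?_ (by fun_prop)
  exact (Kernel.measurable_coe π (measurableSet_singleton a)).ennreal_toReal

lemma measurable_valueDiff {Q : S × A → ℝ} (hQ : Measurable Q) : Measurable (valueDiff π Q) :=
  ((measurable_policyMean hQ).comp measurable_snd).sub (hQ.comp measurable_fst)

variable [IsMarkovKernel π]

lemma policyMean_eq_integral (π : Kernel S A) [IsMarkovKernel π] (Q : S × A → ℝ) (s : S) :
    policyMean π Q s = ∫ a, Q (s, a) ∂(π s) := by
  rw [integral_fintype .of_finite]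
  rfl

lemma abs_policyMean_le {Q : S × A → ℝ} {b : ℝ} (hQ : ∀ x, |Q x| ≤ b) (s : S) :
    |policyMean π Q s| ≤ b := by
  rw [policyMean_eq_integral]
  exact abs_integral_le_of_abs_le _ fun a => hQ _

lemma abs_valueDiff_le {Q : S × A → ℝ} {b : ℝ} (hQ : ∀ x, |Q x| ≤ b) (z : (S × A) × S) :
    |valueDiff π Q z| ≤ 2 * b := by
  have := abs_sub (policyMean π Q z.2) (Q z.1)
  have h1 := abs_policyMean_le (π := π) hQ z.2
  have h2 := hQ z.1
  unfold valueDiff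
  linarith

end Policy

/-! ### Centered rewards -/

/-- The centered modified reward `r_β(s) - M(β, π)`. -/
def centeredReward {S : Type*} [MeasurableSpace S] (c : ℝ) (R : S → ℝ) (d : Measure S) (β : ℝ)
    (s : S) : ℝ :=
  modReward c R β s - objective c R d β

section Reward

lemma shortfall_of_ge {S : Type*} {R : S → ℝ} {Rmax : ℝ}
    (hRb : ∀ s, |R s| ≤ Rmax) {β : ℝ} (hβ : Rmax ≤ β) (s : S) :
    max (β - R s) 0 = β - R s :=
  max_eq_left (by linarith [(abs_le.1 (hRb s)).2])

variable {S : Type*} [MeasurableSpace S] {c : ℝ} {R : S → ℝ} {Rmax : ℝ} {d : Measure S}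

lemma centeredReward_eq (β : ℝ) (s : S) : centeredReward c R d β s =
    1 / (1 - c) * (∫ s, max (β - R s) 0 ∂d - max (β - R s) 0) := by
  simp only [centeredReward, modReward, objective]; ring

@[fun_prop]
lemma measurable_centeredReward (hR : Measurable R) (β : ℝ) :
    Measurable (centeredReward c R d β) := by
  unfold centeredReward modReward
  fun_prop

lemma objective_of_le (hRb : ∀ s, |R s| ≤ Rmax) {β : ℝ} (hβ : β ≤ -Rmax) :
    objective c R d β = β ∧ ∀ s, max (β - R s) 0 = 0 := by
  have h : ∀ s, max (β - R s) 0 = 0 := fun s =>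
    max_eq_right (by linarith [(abs_le.1 (hRb s)).1])
  exact ⟨by simp [objective, h], h⟩

variable [IsProbabilityMeasure d]

lemma integrable_shortfall (hR : Measurable R) (hRb : ∀ s, |R s| ≤ Rmax) (β : ℝ) (μ : Measure S)
    [IsFiniteMeasure μ] : Integrable (fun s => max (β - R s) 0) μ := by
  refine integrable_of_abs_le (b := |β| + Rmax) (by fun_prop) fun s => ?_
  have h1 := abs_le.1 (hRb s)
  have h2 := le_abs_self β
  rw [abs_of_nonneg (le_max_right _ _)]
  exact max_le (by linarith) (by linarith [abs_nonneg β, (abs_nonneg (R s)).trans (hRb s)])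

/-- The shortfall and its mean are both 1-Lipschitz in β, hence the factor 2. -/
lemma abs_centeredReward_sub_le (hR : Measurable R) (hRb : ∀ s, |R s| ≤ Rmax) (hc1 : c < 1)
    (β β' : ℝ) (s : S) :
    |centeredReward c R d β s - centeredReward c R d β' s| ≤ 2 / (1 - c) * |β - β'| := by
  have hc : 0 < 1 - c := by linarith
  have h1 : ∀ s, |max (β - R s) 0 - max (β' - R s) 0| ≤ |β - β'| := fun s => by
    simpa using abs_max_sub_max_le_abs (β - R s) (β' - R s) 0
  have h2 : |∫ s, max (β - R s) 0 ∂d - ∫ s, max (β' - R s) 0 ∂d| ≤ |β - β'| := by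
    rw [← integral_sub (integrable_shortfall hR hRb _ _) (integrable_shortfall hR hRb _ _)]
    exact abs_integral_le_of_abs_le _ h1
  rw [centeredReward_eq, centeredReward_eq, ← mul_sub, abs_mul, abs_of_pos (by positivity)]
  have h3 : |∫ s, max (β - R s) 0 ∂d - max (β - R s) 0 - (∫ s, max (β' - R s) 0 ∂d -
      max (β' - R s) 0)| ≤ 2 * |β - β'| := by
    rw [sub_sub_sub_comm]
    have := abs_sub (∫ s, max (β - R s) 0 ∂d - ∫ s, max (β' - R s) 0 ∂d)
      (max (β - R s) 0 - max (β' - R s) 0)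
    linarith [h1 s]
  calc 1 / (1 - c) * _ ≤ 1 / (1 - c) * (2 * |β - β'|) := by gcongr
    _ = _ := by ring

lemma objective_of_ge (hR : Measurable R) (hRb : ∀ s, |R s| ≤ Rmax) {β : ℝ} (hβ : Rmax ≤ β) :
    objective c R d β = β - 1 / (1 - c) * (β - ∫ s, R s ∂d) := by
  simp only [objective, shortfall_of_ge hRb hβ]
  rw [integral_sub (integrable_const _) (integrable_of_abs_le hR hRb)]
  simp

/-- The centered reward depends on `β` only through its projection onto `[-Rmax, Rmax]`. -/
lemma centeredReward_clamp (hR : Measurable R) (hRb : ∀ s, |R s| ≤ Rmax) (hR0 : 0 ≤ Rmax)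
    (β : ℝ) : centeredReward c R d β = centeredReward c R d (max (-Rmax) (min β Rmax)) := by
  funext s
  rcases le_total β (-Rmax) with h | h
  · rw [min_eq_left (by linarith), max_eq_left h, centeredReward_eq, centeredReward_eq]
    simp [(objective_of_le (c := c) (d := d) hRb h).2,
      (objective_of_le (c := c) (d := d) hRb le_rfl).2]
  · rcases le_total β Rmax with h' | h'
    · rw [min_eq_left h', max_eq_right h]
    -- Above `Rmax` the shortfall is affine in β, and subtracting its mean removes β.
    · rw [min_eq_right h', max_eq_right (by linarith)]
      simp only [centeredReward, modReward, objective_of_ge hR hRb h',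
        objective_of_ge hR hRb le_rfl, shortfall_of_ge hRb h', shortfall_of_ge hRb le_rfl]
      ring

/-- At β = −Rmax the centered reward is zero, and after projection β is at distance at most 2 Rmax
from there. The bound is therefore uniform over all real β, although the modified reward itself is
unbounded in β. -/
lemma abs_centeredReward_le (hR : Measurable R) (hRb : ∀ s, |R s| ≤ Rmax) (hR0 : 0 ≤ Rmax)
    (hc1 : c < 1) (β : ℝ) (s : S) : |centeredReward c R d β s| ≤ 4 * Rmax / (1 - c) := by
  have hc : 0 < 1 - c := by linarith
  rw [centeredReward_clamp hR hRb hR0]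
  have h0 : centeredReward c R d (-Rmax) s = 0 := by
    rw [centeredReward_eq]
    simp [(objective_of_le (c := c) (d := d) hRb le_rfl).2]
  have h := abs_centeredReward_sub_le (d := d) hR hRb hc1 (max (-Rmax) (min β Rmax)) (-Rmax) s
  rw [h0, sub_zero] at h
  refine h.trans ?_
  have h2 : |max (-Rmax) (min β Rmax) - -Rmax| ≤ 2 * Rmax := by
    rw [abs_of_nonneg (by linarith [le_max_left (-Rmax) (min β Rmax)])]
    have : max (-Rmax) (min β Rmax) ≤ Rmax := max_le (by linarith) (min_le_right _ _)
    linarith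
  calc 2 / (1 - c) * _ ≤ 2 / (1 - c) * (2 * Rmax) := by gcongr
    _ = _ := by ring

lemma exists_net_centeredReward (hR : Measurable R) (hRb : ∀ s, |R s| ≤ Rmax) (hR0 : 0 ≤ Rmax)
    (hc1 : c < 1) {ε : ℝ} (hε : 0 < ε) : ∃ t : Finset ℝ, ∀ β, ∃ β' ∈ t, ∀ s,
      |centeredReward c R d β s - centeredReward c R d β' s| ≤ ε := by
  have hc : 0 < 1 - c := by linarith
  obtain ⟨t, -, htf, ht⟩ := (isCompact_Icc (a := -Rmax) (b := Rmax)).finite_cover_balls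
    (e := ε * (1 - c) / 2) (by positivity)
  refine ⟨htf.toFinset, fun β => ?_⟩
  have hmem : max (-Rmax) (min β Rmax) ∈ Set.Icc (-Rmax) Rmax :=
    ⟨le_max_left _ _, max_le (by linarith) (min_le_right _ _)⟩
  obtain ⟨β', hβ', hd⟩ := Set.mem_iUnion₂.1 (ht hmem)
  refine ⟨β', by simpa using hβ', fun s => ?_⟩
  rw [centeredReward_clamp hR hRb hR0 β]
  refine (abs_centeredReward_sub_le hR hRb hc1 _ _ _).trans ?_
  rw [Metric.mem_ball, Real.dist_eq] at hd
  calc 2 / (1 - c) * _ ≤ 2 / (1 - c) * (ε * (1 - c) / 2) := by gcongr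
    _ = ε := by field_simp

/-- The objective attains its maximum. -/
lemma exists_isMax_objective (hR : Measurable R) (hRb : ∀ s, |R s| ≤ Rmax) (hR0 : 0 ≤ Rmax)
    (hc0 : 0 ≤ c) (hc1 : c < 1) :
    ∃ βstar, ∀ β, objective c R d β ≤ objective c R d βstar := by
  have hc : 0 < 1 - c := by linarith
  have hcont : Continuous (objective c R d) := by
    have : LipschitzWith 1 fun β => ∫ s, max (β - R s) 0 ∂d := by
      refine LipschitzWith.of_dist_le_mul fun β β' => ?_
      rw [Real.dist_eq, Real.dist_eq, NNReal.coe_one, one_mul,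
        ← integral_sub (integrable_shortfall hR hRb _ _) (integrable_shortfall hR hRb _ _)]
      exact abs_integral_le_of_abs_le _ fun s => by
        simpa using abs_max_sub_max_le_abs (β - R s) (β' - R s) 0
    have := this.continuous
    unfold objective
    fun_prop
  obtain ⟨b, -, hb⟩ := (isCompact_Icc (a := -Rmax) (b := Rmax)).exists_isMaxOn
    ⟨0, by simpa using hR0⟩ hcont.continuousOn
  refine ⟨b, fun β => ?_⟩
  rcases le_total β (-Rmax) with h | h
  · have h1 : objective c R d (-Rmax) ≤ objective c R d b := hb ⟨le_rfl, by linarith⟩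
    rw [(objective_of_le hRb le_rfl).1] at h1
    rw [(objective_of_le hRb h).1]
    linarith
  · rcases le_total β Rmax with h' | h'
    · exact hb ⟨h, h'⟩
    · have h1 : objective c R d Rmax ≤ objective c R d b := hb ⟨by linarith, le_rfl⟩
      refine le_trans ?_ h1
      rw [objective_of_ge hR hRb le_rfl, objective_of_ge hR hRb h']
      -- To the right of `Rmax` the objective has slope −c / (1 − c) ≤ 0; to the left of −Rmax it
      -- has slope 1. So a maximizer over the compact interval is global.
      have h2 : β - 1 / (1 - c) * (β - ∫ s, R s ∂d) - (Rmax - 1 / (1 - c) * (Rmax - ∫ s, R s ∂d))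
          = -(c / (1 - c) * (β - Rmax)) := by field_simp; ring
      have h3 : 0 ≤ c / (1 - c) * (β - Rmax) := mul_nonneg (by positivity) (by linarith)
      linarith

end Reward

/-! ### Penalties -/

/-- Compare the minimizer with a fixed competitor and drop its nonnegative empirical loss. -/
lemma IsPenalizedFit.penalty_le {S A : Type*} {n T : ℕ} (hn : 0 < n) (hT : 0 < T)
    {Z : ℕ → ℕ → (S × A) × S} {G : Set (S × A → ℝ)} {J : (S × A → ℝ) → ℝ≥0} {μ b : ℝ}
    {y : (S × A) × S → ℝ} {g g' : S × A → ℝ} (h : IsPenalizedFit (sampleMean n T Z) G J μ y g)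
    (hμ : 0 < μ) (hg' : g' ∈ G) (hb : ∀ z, |y z - g' z.1| ≤ b) :
    (J g : ℝ) ^ 2 ≤ b ^ 2 / μ + (J g' : ℝ) ^ 2 := by
  have h1 := h.2 g' hg'
  have h2 : 0 ≤ sampleMean n T Z fun z => (y z - g z.1) ^ 2 :=
    sampleMean_nonneg _ fun z => sq_nonneg _
  have h3 : sampleMean n T Z (fun z => (y z - g' z.1) ^ 2) ≤ b ^ 2 :=
    (le_abs_self _).trans (abs_sampleMean_le hn hT _ fun z => by
      rw [abs_of_nonneg (sq_nonneg _), ← sq_abs]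
      exact pow_le_pow_left₀ (abs_nonneg _) (hb z) 2)
  have h4 : μ * (J g : ℝ) ^ 2 ≤ b ^ 2 + μ * (J g' : ℝ) ^ 2 := by linarith
  have h5 : (J g : ℝ) ^ 2 ≤ (b ^ 2 + μ * (J g' : ℝ) ^ 2) / μ := (le_div_iff₀' hμ).2 h4
  refine h5.trans (le_of_eq ?_)
  field_simp

lemma IsScaledRatioEstimator.penalty_le {S A : Type*} [MeasurableSpace S] [MeasurableSpace A]
    [Fintype A] [MeasurableSingletonClass A] {π : Kernel S A} [IsMarkovKernel π] {n T : ℕ}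
    (hn : 0 < n) (hT : 0 < T) {Z : ℕ → ℕ → (S × A) × S} {F G : Set (S × A → ℝ)}
    {J₁ J₂ : (S × A → ℝ) → ℝ≥0} {lam mu bF bG : ℝ} {eh g' : S × A → ℝ}
    (h : IsScaledRatioEstimator (sampleMean n T Z) π F G J₁ J₂ lam mu eh)
    (hmu : 0 < mu) (hF : ∀ f ∈ F, ∀ x, |f x| ≤ bF) (hG : ∀ g ∈ G, ∀ x, |g x| ≤ bG)
    (hg' : g' ∈ G) : (J₂ eh : ℝ) ^ 2 ≤ (1 + 2 * bF + bG) ^ 2 / mu + (J₂ g' : ℝ) ^ 2 := by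
  obtain ⟨hh, Hh, h1, h2, -, rfl⟩ := h
  refine (h1 Hh h2).penalty_le hn hT hmu hg' fun z => ?_
  have e1 := abs_le.1 (hF Hh h2 z.1)
  have e2 := abs_le.1 (abs_policyMean_le (π := π) (hF Hh h2) z.2)
  have e3 := abs_le.1 (hG g' hg' z.1)
  unfold ratioTdError
  rw [abs_le]
  constructor <;> linarith

/-- The competitor is (0, Q'). Its loss is at most bG² because the inner fit lies in the bounded
class `G`, however large the temporal difference error is. Hence the bound does not depend on β or
on the fitted η. -/
lemma IsValueEstimator.penalty_le {S A : Type*} [MeasurableSpace S] [MeasurableSpace A]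
    [Fintype A] {π : Kernel S A} {n T : ℕ}
    (hn : 0 < n) (hT : 0 < T) {Z : ℕ → ℕ → (S × A) × S} {c : ℝ} {R : S → ℝ}
    {F G : Set (S × A → ℝ)} {J₁ J₂ : (S × A → ℝ) → ℝ≥0} {lam mu β bG : ℝ} {Qh Q' : S × A → ℝ}
    (h : IsValueEstimator (sampleMean n T Z) π c R F G J₁ J₂ lam mu β Qh)
    (hlam : 0 < lam) (hG : ∀ g ∈ G, ∀ x, |g x| ≤ bG) (hQ' : Q' ∈ F) :
    (J₁ Qh : ℝ) ^ 2 ≤ bG ^ 2 / lam + (J₁ Q' : ℝ) ^ 2 := by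
  obtain ⟨gh, ηh, h1, -, h3⟩ := h
  have h4 := h3 0 Q' hQ'
  have h5 : 0 ≤ sampleMean n T Z fun z => gh ηh Qh z.1 ^ 2 :=
    sampleMean_nonneg _ fun z => sq_nonneg _
  have h6 : sampleMean n T Z (fun z => gh 0 Q' z.1 ^ 2) ≤ bG ^ 2 :=
    (le_abs_self _).trans (abs_sampleMean_le hn hT _ fun z => by
      rw [abs_of_nonneg (sq_nonneg _), ← sq_abs]
      exact pow_le_pow_left₀ (abs_nonneg _) (hG _ (h1 0 Q' hQ').1 z.1) 2)
  have h7 : lam * (J₁ Qh : ℝ) ^ 2 ≤ bG ^ 2 + lam * (J₁ Q' : ℝ) ^ 2 := by linarith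
  have h8 : (J₁ Qh : ℝ) ^ 2 ≤ (bG ^ 2 + lam * (J₁ Q' : ℝ) ^ 2) / lam := (le_div_iff₀' hlam).2 h7
  refine h8.trans (le_of_eq ?_)
  field_simp

/-- Tuning parameters of the order of the tuning rate or larger are eventually positive, and their
inverses are at most of the order `N ^ (1 / (1 + α))`. -/
lemma HasTuningRate.exists_inv_le {α : ℝ} (hα0 : 0 < α) {N : ℕ → ℕ} (hN : Tendsto N atTop atTop)
    {lam : ℕ → ℝ} (h : HasTuningRate α N lam) :
    ∃ D > 0, ∀ᶠ k in atTop, 0 < lam k ∧ 1 / lam k ≤ D * (N k : ℝ) ^ (1 / (1 + α)) := by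
  obtain ⟨κ, hκ, h⟩ := h
  refine ⟨1 / κ, by positivity, ?_⟩
  filter_upwards [h, hN.eventually_ge_atTop 3] with k hk hNk
  have hN3 : (3 : ℝ) ≤ N k := by exact_mod_cast hNk
  have hN0 : (0 : ℝ) < N k := by linarith
  -- For N ≥ 3 > e the logarithmic factor is at least one and can be dropped.
  have hlog : 1 ≤ Real.log (N k) := by
    rw [Real.le_log_iff_exp_le hN0]
    linarith [Real.exp_one_lt_d9]
  have h1 : 1 ≤ Real.log (N k) ^ ((2 + α) / (1 + α)) := Real.one_le_rpow hlog (by positivity)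
  have h2 : κ * (N k : ℝ) ^ (-1 / (1 + α)) ≤ lam k := by
    refine le_trans ?_ hk
    unfold tuningRate
    gcongr
    exact le_mul_of_one_le_left (by positivity) h1
  have h3 : 0 < κ * (N k : ℝ) ^ (-1 / (1 + α)) := by positivity
  refine ⟨h3.trans_le h2, (one_div_le_one_div_of_le h3 h2).trans (le_of_eq ?_)⟩
  rw [neg_div, Real.rpow_neg hN0.le]
  field_simp

/-! ### A uniform law of large numbers -/

section Classes

variable {S A : Type*} [MeasurableSpace S] [MeasurableSpace A]

lemma IsFunctionClass.exists_net {F : Set (S × A → ℝ)} {J : (S × A → ℝ) → ℝ≥0} {B C α : ℝ}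
    (hF : IsFunctionClass F J B C α) {ε M : ℝ} (hε : 0 < ε) (hM : 0 < M) :
    ∃ s : Finset (S × A → ℝ), (∀ g ∈ s, g ∈ F) ∧
      (s.card : ℝ) ≤ Real.exp (C * (M / ε) ^ (2 * α)) ∧
      ∀ f ∈ F, (J f : ℝ) ≤ M → ∃ g ∈ s, ∀ x, |f x - g x| ≤ 2 * ε := by
  classical
  obtain ⟨t, ht, hcov⟩ := hF.entropy ε hε M hM
  let p : (S × A → ℝ) → (S × A → ℝ) → Prop := fun g f => f ∈ F ∧ ∀ x, |f x - g x| ≤ ε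
  let r : (S × A → ℝ) → (S × A → ℝ) := fun g => if h : ∃ f, p g f then h.choose else g
  have hr : ∀ g, (∃ f, p g f) → p g (r g) := fun g h => by
    simp only [r, h, dif_pos]
    exact h.choose_spec
  refine ⟨(t.filter fun g => ∃ f, p g f).image r, ?_, ?_, ?_⟩
  · intro g hg
    obtain ⟨g', hg', rfl⟩ := Finset.mem_image.1 hg
    exact (hr g' (Finset.mem_filter.1 hg').2).1
  · have h1 : ((t.filter fun g => ∃ f, p g f).image r).card ≤ t.card :=
      Finset.card_image_le.trans (Finset.card_filter_le _ _)
    have h2 : (((t.filter fun g => ∃ f, p g f).image r).card : ℝ) ≤ t.card := by exact_mod_cast h1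
    refine h2.trans ((Real.le_exp_log _).trans (Real.exp_le_exp.2 ht))
  · intro f hf hfM
    obtain ⟨g, hg, hfg⟩ := hcov f hf hfM
    have hex : ∃ f, p g f := ⟨f, hf, hfg⟩
    refine ⟨r g, Finset.mem_image_of_mem _ (Finset.mem_filter.2 ⟨hg, hex⟩), fun x => ?_⟩
    have h1 := abs_le.1 (hfg x)
    have h2 := abs_le.1 ((hr g hex).2 x)
    rw [abs_le]
    constructor <;> linarith

variable [Fintype A]

/-- The function `(s, a, s') ↦ e(s, a) (h(s) + ∑_{a'} π(a' | s') Q(s', a') - Q(s, a))`. -/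
def weightedTd (π : Kernel S A) (h : S → ℝ) (e Q : S × A → ℝ) (z : (S × A) × S) : ℝ :=
  e z.1 * (h z.1.1 + valueDiff π Q z)

variable [MeasurableSingletonClass A] {π : Kernel S A}

lemma measurable_weightedTd {h : S → ℝ} {e Q : S × A → ℝ} (hh : Measurable h) (he : Measurable e)
    (hQ : Measurable Q) : Measurable (weightedTd π h e Q) :=
  (he.comp measurable_fst).mul
    ((hh.comp (measurable_fst.comp measurable_fst)).add (measurable_valueDiff hQ))

variable [IsMarkovKernel π]

lemma abs_weightedTd_le {h : S → ℝ} {e Q : S × A → ℝ} {bh bG bF : ℝ} (hh : ∀ s, |h s| ≤ bh)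
    (he : ∀ x, |e x| ≤ bG) (hQ : ∀ x, |Q x| ≤ bF) (z : (S × A) × S) :
    |weightedTd π h e Q z| ≤ bG * (bh + 2 * bF) := by
  rw [weightedTd, abs_mul]
  have h1 := abs_valueDiff_le (π := π) hQ z
  exact mul_le_mul (he _) ((abs_add_le _ _).trans (add_le_add (hh _) h1)) (abs_nonneg _)
    ((abs_nonneg _).trans (he z.1))

lemma abs_weightedTd_sub_le {h h' : S → ℝ} {e e' Q Q' : S × A → ℝ} {bh bG bF ε : ℝ}
    (hh : ∀ s, |h s| ≤ bh) (he : ∀ x, |e' x| ≤ bG) (hQ : ∀ x, |Q x| ≤ bF)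
    (hhε : ∀ s, |h s - h' s| ≤ ε) (heε : ∀ x, |e x - e' x| ≤ 2 * ε)
    (hQε : ∀ x, |Q x - Q' x| ≤ 2 * ε) (z : (S × A) × S) :
    |weightedTd π h e Q z - weightedTd π h' e' Q' z| ≤
      ε * (2 * (bh + 2 * bF) + 5 * bG) := by
  have h1 : weightedTd π h e Q z - weightedTd π h' e' Q' z =
      (e z.1 - e' z.1) * (h z.1.1 + valueDiff π Q z) +
      e' z.1 * ((h z.1.1 - h' z.1.1) + valueDiff π (fun x => Q x - Q' x) z) := by
    rw [← valueDiff_sub]; unfold weightedTd; ring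
  rw [h1]
  refine (abs_add_le _ _).trans ?_
  rw [abs_mul, abs_mul]
  have h2 := abs_valueDiff_le (π := π) hQ z
  have h3 := abs_valueDiff_le (π := π) hQε z
  have hε : 0 ≤ 2 * ε := (abs_nonneg _).trans (heε z.1)
  calc |e z.1 - e' z.1| * |h z.1.1 + valueDiff π Q z| +
        |e' z.1| * |(h z.1.1 - h' z.1.1) + valueDiff π (fun x => Q x - Q' x) z|
      ≤ (2 * ε) * (bh + 2 * bF) + bG * (ε + 2 * (2 * ε)) := by
        refine add_le_add (mul_le_mul (heε _) ((abs_add_le _ _).trans (add_le_add (hh _) h2))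
          (abs_nonneg _) hε) (mul_le_mul (he _) ((abs_add_le _ _).trans (add_le_add (hhε _) h3))
          (abs_nonneg _) ((abs_nonneg _).trans (he z.1)))
    _ = _ := by ring

lemma exists_net_weightedTd {F G : Set (S × A → ℝ)} {J₁ J₂ : (S × A → ℝ) → ℝ≥0} {bF bG C α : ℝ}
    (hF : IsFunctionClass F J₁ bF C α) (hG : IsFunctionClass G J₂ bG C α) (hbF : 0 ≤ bF)
    (hbG : 0 ≤ bG) {h : ℝ → S → ℝ} {bh : ℝ} (hbh : 0 ≤ bh) (hh : ∀ β s, |h β s| ≤ bh)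
    (hhm : ∀ β, Measurable (h β))
    (hnet : ∀ ε > 0, ∃ t : Finset ℝ, ∀ β, ∃ β' ∈ t, ∀ s, |h β s - h β' s| ≤ ε)
    {ε : ℝ} (hε : 0 < ε) :
    ∃ ε' > 0, ∃ K : ℕ, ∀ M > 0, ∃ H : Finset ((S × A) × S → ℝ),
      (∀ f ∈ H, Measurable f ∧ ∀ z, |f z| ≤ bG * (bh + 2 * bF)) ∧
      (H.card : ℝ) ≤ K * Real.exp (2 * (C * (M / ε') ^ (2 * α))) ∧
      ∀ e ∈ G, (J₂ e : ℝ) ≤ M → ∀ Q ∈ F, (J₁ Q : ℝ) ≤ M → ∀ β, ∃ f ∈ H,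
        ∀ z, |weightedTd π (h β) e Q z - f z| ≤ ε := by
  classical
  set D : ℝ := 2 * (bh + 2 * bF) + 5 * bG + 1 with hD
  have hD0 : 0 < D := by positivity
  refine ⟨ε / D, by positivity, ?_⟩
  obtain ⟨t, ht⟩ := hnet (ε / D) (by positivity)
  refine ⟨t.card, fun M hM => ?_⟩
  obtain ⟨sF, hsF, hcF, hnF⟩ := hF.exists_net (ε := ε / D) (by positivity) hM
  obtain ⟨sG, hsG, hcG, hnG⟩ := hG.exists_net (ε := ε / D) (by positivity) hM
  refine ⟨(t ×ˢ sG ×ˢ sF).image fun p => weightedTd π (h p.1) p.2.1 p.2.2, ?_, ?_, ?_⟩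
  · intro f hf
    obtain ⟨p, hp, rfl⟩ := Finset.mem_image.1 hf
    simp only [Finset.mem_product] at hp
    exact ⟨measurable_weightedTd (hhm _) (hG.measurable _ (hsG _ hp.2.1))
        (hF.measurable _ (hsF _ hp.2.2)),
      abs_weightedTd_le (hh _) (hG.bounded _ (hsG _ hp.2.1)) (hF.bounded _ (hsF _ hp.2.2))⟩
  · have h1 : (((t ×ˢ sG ×ˢ sF).image fun p => weightedTd π (h p.1) p.2.1 p.2.2).card : ℝ) ≤
        t.card * (sG.card * sF.card) := by
      have : ((t ×ˢ sG ×ˢ sF).image fun p => weightedTd π (h p.1) p.2.1 p.2.2).card ≤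
        t.card * (sG.card * sF.card) := Finset.card_image_le.trans (by simp [Finset.card_product])
      exact_mod_cast this
    refine h1.trans ?_
    rw [two_mul, Real.exp_add]
    gcongr
  · intro e he heM Q hQ hQM β
    obtain ⟨β', hβ', hβ⟩ := ht β
    obtain ⟨e', he', hee⟩ := hnG e he heM
    obtain ⟨Q', hQ', hQQ⟩ := hnF Q hQ hQM
    refine ⟨_, Finset.mem_image.2 ⟨(β', e', Q'), by simp [hβ', he', hQ'], rfl⟩, fun z => ?_⟩
    refine (abs_weightedTd_sub_le (hh β) (hG.bounded _ (hsG _ he')) (hF.bounded _ hQ) hβ hee hQQ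
      z).trans ?_
    rw [div_mul_eq_mul_div, div_le_iff₀ hD0]
    gcongr
    linarith

end Classes

lemma tendsto_deviation_bound (K C' c' b₀ : ℝ) {b₁ : ℝ} (hc' : 0 < c') (hb₁ : 0 < b₁) :
    Tendsto (fun y : ℝ => K * (y * Real.exp (C' * y ^ 2 - c' * y ^ 3)) +
      b₀ * (y ^ 4 * Real.exp (-(b₁ * y)))) atTop (𝓝 0) := by
  have h1 : Tendsto (fun y : ℝ => y ^ 4 * Real.exp (-(b₁ * y))) atTop (𝓝 0) := by
    have := (Real.tendsto_pow_mul_exp_neg_atTop_nhds_zero 4).comp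
      (tendsto_id.const_mul_atTop hb₁)
    have := this.const_mul (1 / b₁ ^ 4)
    rw [mul_zero] at this
    refine this.congr fun y => ?_
    simp only [Function.comp, id]
    field_simp
  have h2 : Tendsto (fun y : ℝ => y * Real.exp (C' * y ^ 2 - c' * y ^ 3)) atTop (𝓝 0) := by
    have h3 := Real.tendsto_pow_mul_exp_neg_atTop_nhds_zero 1
    refine squeeze_zero' ?_ ?_ h3
    · filter_upwards [eventually_ge_atTop 0] with y hy
      positivity
    · filter_upwards [eventually_ge_atTop 1, eventually_ge_atTop ((C' + 1) / c')] with y hy hy'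
      rw [pow_one]
      gcongr
      have h4 : C' + 1 ≤ c' * y := by rwa [div_le_iff₀' hc'] at hy'
      have h5 : (C' + 1) * y ^ 2 ≤ c' * y * y ^ 2 := by gcongr
      nlinarith
  have := (h2.const_mul K).add (h1.const_mul b₀)
  simpa using this

section Sampling

variable {S A Ω : Type*} [MeasurableSpace S] [MeasurableSpace A] [Fintype A]
  [MeasurableSingletonClass A] [MeasurableSpace Ω]
  {P : Kernel (S × A) S} [IsMarkovKernel P] {π πb : Kernel S A} [IsMarkovKernel π]
  [IsMarkovKernel πb]
  {ρ : Measure (S × A)} [IsProbabilityMeasure ρ] {Pr : Measure Ω} [IsProbabilityMeasure Pr]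
  {X : ℕ → ℕ → Ω → S × A}

lemma tendsto_measure_deviation (hchain : ∀ i, IsMarkovChain Pr (pairKernel P πb) ρ (X i))
    (hindep : iIndepFun (fun i ω t => X i t ω) Pr) (hρ : Kernel.Invariant (pairKernel P πb) ρ)
    {b₀ b₁ : ℝ} (hb₀ : 0 ≤ b₀) (hb₁ : 0 < b₁) (hmix : ∀ i, IsExpBetaMixing Pr (X i) b₀ b₁)
    {n T : ℕ → ℕ} (hn : ∀ k, 0 < n k) (hT : ∀ k, 0 < T k)
    (hN : Tendsto (fun k => n k * T k) atTop atTop)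
    {F G : Set (S × A → ℝ)} {J₁ J₂ : (S × A → ℝ) → ℝ≥0} {bF bG C α : ℝ} (hC : 0 < C)
    (hF : IsFunctionClass F J₁ bF C α) (hG : IsFunctionClass G J₂ bG C α) (hbF : 0 ≤ bF)
    (hbG : 0 ≤ bG) {h : ℝ → S → ℝ} {bh : ℝ} (hbh : 0 ≤ bh) (hh : ∀ β s, |h β s| ≤ bh)
    (hhm : ∀ β, Measurable (h β))
    (hnet : ∀ ε > 0, ∃ t : Finset ℝ, ∀ β, ∃ β' ∈ t, ∀ s, |h β s - h β' s| ≤ ε)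
    {M : ℕ → ℝ} {D : ℝ} (hM : ∀ᶠ k in atTop, 0 < M k ∧
      M k ^ (2 * α) ≤ D * ((n k * T k : ℕ) : ℝ) ^ (1 / 2 : ℝ)) {ε : ℝ} (hε : 0 < ε) :
    Tendsto (fun k => Pr {ω | ∃ e ∈ G, (J₂ e : ℝ) ≤ M k ∧ ∃ Q ∈ F, (J₁ Q : ℝ) ≤ M k ∧ ∃ β,
      ε ≤ |sampleMean (n k) (T k) (transition X ω) (weightedTd π (h β) e Q) -
        ∫ z, weightedTd π (h β) e Q z ∂(ρ ⊗ₘ P)|}) atTop (𝓝 0) := by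
  obtain ⟨ε', hε', K, hnetH⟩ := exists_net_weightedTd (π := π) hF hG hbF hbG hbh hh hhm hnet
    (ε := ε / 4) (by positivity)
  set B : ℝ := bG * (bh + 2 * bF) + 1 with hB
  have hB0 : 0 < B := by positivity
  set C' : ℝ := 2 * (C * (D / ε' ^ (2 * α))) with hC'
  set c' : ℝ := (ε / 2) ^ 2 / (16 * B ^ 2) with hc'
  let y : ℕ → ℝ := fun k => ((n k * T k : ℕ) : ℝ) ^ (1 / 4 : ℝ)
  have hy : Tendsto y atTop atTop :=
    (tendsto_rpow_atTop (by norm_num)).comp (tendsto_natCast_atTop_atTop.comp hN)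
  have hlim := (tendsto_deviation_bound (8 * K) C' c' b₀ (by positivity) hb₁).comp hy
  have hlim2 := ENNReal.tendsto_ofReal hlim
  rw [ENNReal.ofReal_zero] at hlim2
  refine tendsto_of_tendsto_of_tendsto_of_le_of_le' tendsto_const_nhds hlim2
    (Eventually.of_forall fun k => zero_le) ?_
  filter_upwards [hM, hN.eventually_ge_atTop 1, hy.eventually_ge_atTop 1] with k hMk hNk hyk
  obtain ⟨H, hH1, hH2, hH3⟩ := hnetH (M k) hMk.1
  have hsub : {ω | ∃ e ∈ G, (J₂ e : ℝ) ≤ M k ∧ ∃ Q ∈ F, (J₁ Q : ℝ) ≤ M k ∧ ∃ β,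
      ε ≤ |sampleMean (n k) (T k) (transition X ω) (weightedTd π (h β) e Q) -
        ∫ z, weightedTd π (h β) e Q z ∂(ρ ⊗ₘ P)|} ⊆
      {ω | ∃ f ∈ H, ε / 2 ≤ |sampleMean (n k) (T k) (transition X ω) f -
        ∫ z, f z ∂(ρ ⊗ₘ P)|} := by
    rintro ω ⟨e, he, heM, Q, hQ, hQM, β, hdev⟩
    obtain ⟨f, hf, hfz⟩ := hH3 e he heM Q hQ hQM β
    refine ⟨f, hf, ?_⟩
    have h1 := abs_sampleMean_le (hn k) (hT k) (transition X ω) hfz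
    rw [← sampleMean_sub] at h1
    have h2 := abs_integral_le_of_abs_le (ρ ⊗ₘ P) hfz
    rw [integral_sub (integrable_of_abs_le (measurable_weightedTd (hhm _) (hG.measurable _ he)
      (hF.measurable _ hQ)) (abs_weightedTd_le (hh _) (hG.bounded _ he) (hF.bounded _ hQ)))
      (integrable_of_abs_le (hH1 f hf).1 (hH1 f hf).2)] at h2
    rw [abs_le] at h1 h2
    rw [le_abs] at hdev ⊢
    rcases hdev with hd | hd
    · left; linarith
    · right; linarith
  set a : ℕ := ⌈y k⌉₊ + 1 with ha
  have hy0 : 0 < y k := by linarith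
  have ha2 : 2 ≤ a := by
    have : 1 ≤ ⌈y k⌉₊ := Nat.one_le_ceil_iff.2 hy0
    omega
  have hal : y k ≤ ((a - 1 : ℕ) : ℝ) := by
    simp only [ha, Nat.add_sub_cancel]
    exact Nat.le_ceil _
  have hau : (a : ℝ) ≤ 4 * y k := by
    have := Nat.ceil_lt_add_one hy0.le
    simp only [ha]; push_cast; linarith
  have ha0 : (0 : ℝ) < a := by positivity
  have hN0 : (0 : ℝ) ≤ ((n k * T k : ℕ) : ℝ) := by positivity
  have hyN : y k ^ 4 = (n k : ℝ) * T k := by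
    simp only [y]
    rw [← Real.rpow_natCast, ← Real.rpow_mul hN0]
    norm_num
  have hyN2 : y k ^ 2 = ((n k * T k : ℕ) : ℝ) ^ (1 / 2 : ℝ) := by
    simp only [y]
    rw [← Real.rpow_natCast, ← Real.rpow_mul hN0]
    norm_num
  refine (measure_mono hsub).trans ((measure_exists_sampleMean_le hchain hindep hρ hb₀ hmix (hn k)
    (hT k) ha2 hB0 (fun f hf => (hH1 f hf).1) (fun f hf z => ((hH1 f hf).2 z).trans (by simp [hB]))
    (by positivity : 0 < ε / 2)).trans ?_)
  have hcard : (H.card : ℝ) ≤ K * Real.exp (C' * y k ^ 2) := by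
    have h1 : 2 * (C * (M k / ε') ^ (2 * α)) ≤ C' * y k ^ 2 := by
      rw [hC', Real.div_rpow hMk.1.le hε'.le, mul_assoc, mul_assoc, div_mul_eq_mul_div, hyN2]
      gcongr
      exact hMk.2
    exact hH2.trans (by gcongr)
  have hexp : Real.exp (-((ε / 2) ^ 2 * (n k * T k) / (4 * a * B ^ 2))) ≤
      Real.exp (-(c' * y k ^ 3)) := by
    gcongr
    rw [hc', ← hyN, div_mul_eq_mul_div, div_le_div_iff₀ (by positivity) (by positivity)]
    calc (ε / 2) ^ 2 * y k ^ 3 * (4 * a * B ^ 2)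
        ≤ (ε / 2) ^ 2 * y k ^ 3 * (4 * (4 * y k) * B ^ 2) := by gcongr
      _ = _ := by ring
  have hexp2 : Real.exp (-b₁ * (a - 1 : ℕ)) ≤ Real.exp (-(b₁ * y k)) := by
    rw [neg_mul]
    gcongr
  have e1 : (a : ℝ≥0∞) = ENNReal.ofReal a := by simp
  have e2 : (H.card : ℝ≥0∞) = ENNReal.ofReal H.card := by simp
  have e3 : (n k : ℝ≥0∞) = ENNReal.ofReal (n k) := by simp
  have e4 : (T k : ℝ≥0∞) = ENNReal.ofReal (T k) := by simp
  rw [e1, e2, e3, e4, ← ENNReal.ofReal_mul (by positivity), ← ENNReal.ofReal_mul (by positivity),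
    ← ENNReal.ofReal_mul (by positivity), ← ENNReal.ofReal_mul (by positivity),
    ← ENNReal.ofReal_add (by positivity) (by positivity)]
  apply ENNReal.ofReal_le_ofReal
  simp only [Function.comp]
  refine add_le_add ?_ ?_
  · calc (a : ℝ) * (H.card * (2 * Real.exp (-((ε / 2) ^ 2 * (n k * T k) / (4 * a * B ^ 2)))))
        ≤ (4 * y k) * ((K * Real.exp (C' * y k ^ 2)) * (2 * Real.exp (-(c' * y k ^ 3)))) := by
          gcongr
      _ = _ := by rw [sub_eq_add_neg, Real.exp_add]; ring
  · rw [← mul_assoc, ← hyN]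
    calc y k ^ 4 * (b₀ * Real.exp (-b₁ * (a - 1 : ℕ)))
        ≤ y k ^ 4 * (b₀ * Real.exp (-(b₁ * y k))) := by gcongr
      _ = _ := by ring

end Sampling

/-! ### Integration against compositions of kernels -/

lemma isMarkovKernel_pow {α : Type*} [MeasurableSpace α] (κ : Kernel α α) [IsMarkovKernel κ] :
    ∀ n : ℕ, IsMarkovKernel (κ ^ n)
  | 0 => by rw [pow_zero]; exact inferInstanceAs (IsMarkovKernel Kernel.id)
  | n + 1 => by
    have := isMarkovKernel_pow κ n
    rw [pow_succ]; exact inferInstanceAs (IsMarkovKernel ((κ ^ n) ∘ₖ κ))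

lemma integral_bind_kernel {α β : Type*} [MeasurableSpace α] [MeasurableSpace β]
    (μ : Measure α) (κ : Kernel α β) {f : β → ℝ} (hf : Integrable f (μ.bind κ)) :
    ∫ y, f y ∂(μ.bind κ) = ∫ x, ∫ y, f y ∂(κ x) ∂μ := by
  have h1 : (κ ∘ₖ Kernel.const Unit μ) () = μ.bind κ := by rw [Kernel.comp_const]; rfl
  have h2 := Kernel.integral_comp (a := ()) (κ := Kernel.const Unit μ) (η := κ) (f := f)
    (by rwa [h1])
  rw [h1] at h2
  exact h2

lemma measurable_integral_kernel {α β : Type*} [MeasurableSpace α] [MeasurableSpace β]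
    (κ : Kernel α β) {f : β → ℝ} (hf : Measurable f) : Measurable fun x => ∫ y, f y ∂(κ x) :=
  (hf.stronglyMeasurable.integral_kernel).measurable

lemma integral_fst_compProd {α β : Type*} [MeasurableSpace α] [MeasurableSpace β]
    (μ : Measure α) [SFinite μ] (κ : Kernel α β) [IsMarkovKernel κ] {h : α → ℝ}
    (hh : Measurable h) : ∫ x, h x.1 ∂(μ ⊗ₘ κ) = ∫ s, h s ∂μ := by
  have hf : (μ ⊗ₘ κ).map Prod.fst = μ := Measure.fst_compProd μ κ
  conv_rhs => rw [← hf]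
  rw [integral_map measurable_fst.aemeasurable hh.aestronglyMeasurable]

section Population

variable {S A : Type*} [MeasurableSpace S] [MeasurableSpace A] {P : Kernel (S × A) S}
  {π : Kernel S A} [IsMarkovKernel π]

lemma invariant_compProd {d : Measure S} [IsProbabilityMeasure d]
    (hd : Kernel.Invariant (stateKernel P π) d) :
    Kernel.Invariant (pairKernel P π) (d ⊗ₘ π) := by
  have h1 : (d ⊗ₘ π).bind P = d := by
    rw [Measure.compProd_eq_comp_prod, Measure.comp_assoc]
    exact hd
  rw [Kernel.Invariant, pairKernel, ← Measure.comp_assoc, h1, Measure.compProd_eq_comp_prod]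

variable [IsMarkovKernel P]

lemma pairKernel_apply (x : S × A) : pairKernel P π x = (P x) ⊗ₘ π := by
  rw [pairKernel, Kernel.comp_apply, Measure.compProd_eq_comp_prod]

variable [Fintype A] [MeasurableSingletonClass A]

lemma integral_policyMean {Q : S × A → ℝ} (hQ : Measurable Q) {b : ℝ} (hb : ∀ x, |Q x| ≤ b)
    (x : S × A) : ∫ s, policyMean π Q s ∂(P x) = ∫ y, Q y ∂(pairKernel P π x) := by
  rw [pairKernel_apply, Measure.integral_compProd (integrable_of_abs_le hQ hb)]
  simp only [policyMean_eq_integral]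

/-- Conditional expectations of the temporal difference. -/
lemma integral_weightedTd_kernel {h : S → ℝ} {e Q : S × A → ℝ} (hQ : Measurable Q) {b : ℝ}
    (hb : ∀ x, |Q x| ≤ b) (x : S × A) :
    ∫ s, weightedTd π h e Q (x, s) ∂(P x) =
      e x * (h x.1 + (∫ y, Q y ∂(pairKernel P π x) - Q x)) := by
  simp only [weightedTd, valueDiff]
  rw [integral_const_mul, integral_add, integral_sub, integral_policyMean hQ hb]
  · simp
  · exact integrable_of_abs_le (measurable_policyMean hQ) (abs_policyMean_le hb)
  · exact integrable_const _
  · exact integrable_const _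
  · exact (integrable_of_abs_le (measurable_policyMean hQ) (abs_policyMean_le hb)).sub
      (integrable_const _)

lemma lintegral_enorm_policyMean_le (ρ : Measure (S × A)) [IsProbabilityMeasure ρ]
    {f : S × A → ℝ} (hf : Measurable f) :
    ∫⁻ z, ‖policyMean π f z.2‖ₑ ∂(ρ ⊗ₘ P) ≤ ∫⁻ y, ‖f y‖ₑ ∂(ρ.bind (pairKernel P π)) := by
  have hm := (measurable_policyMean (π := π) hf)
  rw [Measure.lintegral_compProd (by fun_prop),
    Measure.lintegral_bind (Kernel.aemeasurable _) hf.enorm.aemeasurable]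
  refine lintegral_mono fun x => ?_
  rw [pairKernel_apply, Measure.lintegral_compProd hf.enorm]
  refine lintegral_mono fun s => ?_
  rw [policyMean_eq_integral]
  exact enorm_integral_le_lintegral_enorm _

/-- The ratio function removes the effect of the behavior policy: the weighted temporal difference
has mean zero for every choice of the value function. -/
lemma integral_weightedTd_ratio {ρ : Measure (S × A)} [IsProbabilityMeasure ρ] {d : Measure S}
    [IsProbabilityMeasure d] (hd : Kernel.Invariant (stateKernel P π) d) (hac : d ⊗ₘ π ≪ ρ)
    {W : ℝ} (hW : ∀ᵐ x ∂ρ, ratio ρ d π x ≤ W) {h : S → ℝ} (hh : Measurable h) {bh : ℝ}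
    (hbh : ∀ s, |h s| ≤ bh) (hh0 : ∫ s, h s ∂d = 0) {Q : S × A → ℝ} (hQ : Measurable Q) {bF : ℝ}
    (hbF : ∀ x, |Q x| ≤ bF) :
    Integrable (weightedTd π h (ratio ρ d π) Q) (ρ ⊗ₘ P) ∧
      ∫ z, weightedTd π h (ratio ρ d π) Q z ∂(ρ ⊗ₘ P) = 0 := by
  have hrm : Measurable (ratio ρ d π) := (Measure.measurable_rnDeriv _ _).ennreal_toReal
  have hfst : (ρ ⊗ₘ P).map Prod.fst = ρ := Measure.fst_compProd ρ P
  have hint : Integrable (weightedTd π h (ratio ρ d π) Q) (ρ ⊗ₘ P) := by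
    refine Integrable.of_bound (C := W * (bh + 2 * bF))
      (measurable_weightedTd hh hrm hQ).aestronglyMeasurable ?_
    have hW' : ∀ᵐ z ∂(ρ ⊗ₘ P), ratio ρ d π z.1 ≤ W := by
      refine ae_of_ae_map (p := fun x => ratio ρ d π x ≤ W) measurable_fst.aemeasurable ?_
      rwa [hfst]
    filter_upwards [hW'] with z hz
    rw [Real.norm_eq_abs, weightedTd, abs_mul, abs_of_nonneg (show 0 ≤ ratio ρ d π z.1 from
      ENNReal.toReal_nonneg)]
    have h1 := abs_valueDiff_le (π := π) hbF z
    exact mul_le_mul hz ((abs_add_le _ _).trans (add_le_add (hbh _) h1)) (abs_nonneg _)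
      ((ENNReal.toReal_nonneg).trans hz)
  refine ⟨hint, ?_⟩
  rw [Measure.integral_compProd hint]
  simp only [integral_weightedTd_kernel hQ hbF]
  have h1 := integral_rnDeriv_smul hac
    (f := fun x => h x.1 + (∫ y, Q y ∂(pairKernel P π x) - Q x))
  simp only [smul_eq_mul] at h1
  simp only [ratio]
  have hQint : Integrable Q (d ⊗ₘ π) := integrable_of_abs_le hQ hbF
  have hKint : Integrable (fun x => ∫ y, Q y ∂(pairKernel P π x)) (d ⊗ₘ π) :=
    integrable_of_abs_le (measurable_integral_kernel _ hQ)
      fun x => abs_integral_le_of_abs_le _ hbF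
  have hhint : Integrable (fun x : S × A => h x.1) (d ⊗ₘ π) :=
    integrable_of_abs_le (by fun_prop) fun x => hbh _
  have h4 : ∫ x, (h x.1 + (∫ y, Q y ∂(pairKernel P π x) - Q x)) ∂(d ⊗ₘ π) =
      ∫ x, h x.1 ∂(d ⊗ₘ π) + ∫ x, (∫ y, Q y ∂(pairKernel P π x) - Q x) ∂(d ⊗ₘ π) :=
    integral_add hhint (hKint.sub hQint)
  rw [h1, h4, integral_sub hKint hQint]
  have hinv := invariant_compProd hd
  have h2 := integral_bind_kernel (d ⊗ₘ π) (pairKernel P π) (f := Q) (by rwa [hinv.def])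
  rw [hinv.def] at h2
  rw [integral_fst_compProd d π hh, hh0, ← h2]; simp

end Population

/-! ### Iterated conditional expectations -/

/-- The conditional expectation of `f` at time `k` of the chain started at `x`. -/
def iterMean {E : Type*} [MeasurableSpace E] (K : Kernel E E) (f : E → ℝ) (k : ℕ) (x : E) : ℝ :=
  ∫ y, f y ∂((K ^ k) x)

/-- The averages of the partial sums of the iterated conditional expectations. -/
def cesaroSum {E : Type*} [MeasurableSpace E] (K : Kernel E E) (f : E → ℝ) (τ : ℕ) (x : E) : ℝ :=
  (1 / (τ : ℝ)) * ∑ t ∈ Finset.Icc 1 τ, ∑ k ∈ Finset.range t, iterMean K f k x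

lemma summable_of_le_half {u : ℕ → ℝ} (hu : ∀ k, 0 ≤ u k) {t : ℕ}
    (h : ∀ k, u (k + t) ≤ 1 / 2 * u k) : Summable u := by
  refine summable_of_sum_range_le (c := 2 * ∑ k ∈ Finset.range t, u k) hu fun n => ?_
  have h1 : ∑ k ∈ Finset.range n, u k ≤ ∑ k ∈ Finset.range (t + n), u k :=
    Finset.sum_le_sum_of_subset_of_nonneg (Finset.range_subset_range.2 (by omega))
      fun k _ _ => hu k
  rw [Finset.sum_range_add] at h1
  have h2 : ∑ k ∈ Finset.range n, u (t + k) ≤ ∑ k ∈ Finset.range n, 1 / 2 * u k :=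
    Finset.sum_le_sum fun k _ => by rw [add_comm]; exact h k
  rw [← Finset.mul_sum] at h2
  linarith

section Iterates

variable {E : Type*} [MeasurableSpace E] {K : Kernel E E} {f : E → ℝ}

lemma measurable_iterMean (hf : Measurable f) (k : ℕ) : Measurable (iterMean K f k) :=
  measurable_integral_kernel _ hf

lemma measurable_cesaroSum (hf : Measurable f) (τ : ℕ) : Measurable (cesaroSum K f τ) := by
  have := measurable_iterMean (K := K) hf
  unfold cesaroSum
  fun_prop

lemma iterMean_zero (hf : Measurable f) : iterMean K f 0 = f := by
  funext x
  have h : (K ^ 0) x = Measure.dirac x := by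
    rw [pow_zero]; exact Kernel.id_apply x
  rw [iterMean, h, integral_dirac' _ _ hf.stronglyMeasurable]

lemma enorm_cesaroSum_le (τ : ℕ) (x : E) :
    ‖cesaroSum K f τ x‖ₑ ≤ ∑' k, ‖iterMean K f k x‖ₑ := by
  by_cases h : ∑' k, ‖iterMean K f k x‖ₑ = ⊤
  · rw [h]; exact le_top
  have hs : Summable fun k => |iterMean K f k x| := tsum_enorm_ne_top_iff_summable_norm.1 h
  have h1 : ∀ t, |∑ k ∈ Finset.range t, iterMean K f k x| ≤ ∑' k, |iterMean K f k x| := fun t =>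
    (Finset.abs_sum_le_sum_abs _ _).trans (hs.sum_le_tsum _ fun k _ => abs_nonneg _)
  have h2 : |cesaroSum K f τ x| ≤ ∑' k, |iterMean K f k x| := by
    rw [cesaroSum, abs_mul, abs_of_nonneg (by positivity)]
    have h3 : |∑ t ∈ Finset.Icc 1 τ, ∑ k ∈ Finset.range t, iterMean K f k x| ≤
        τ * ∑' k, |iterMean K f k x| := by
      refine (Finset.abs_sum_le_sum_abs _ _).trans
        ((Finset.sum_le_sum fun t _ => h1 t).trans ?_)
      simp
    have h0 : 0 ≤ ∑' k, |iterMean K f k x| := tsum_nonneg fun k => abs_nonneg _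
    rcases Nat.eq_zero_or_pos τ with rfl | hτ
    · simpa using h0
    · have hτ' : (0 : ℝ) < τ := by exact_mod_cast hτ
      rw [one_div, inv_mul_le_iff₀ hτ']
      exact h3
  simp only [Real.enorm_eq_ofReal_abs]
  rw [← ENNReal.ofReal_tsum_of_nonneg (fun k => abs_nonneg _) hs]
  exact ENNReal.ofReal_le_ofReal h2

/-- If the iterated conditional expectations are summable, then the Cesàro sums converge in mean. -/
lemma tendsto_lintegral_cesaroSum_sub (hf : Measurable f) {σ : Measure E}
    (hσ : ∑' k, ∫⁻ x, ‖iterMean K f k x‖ₑ ∂σ ≠ ⊤) {q : E → ℝ}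
    (hq : ∀ x, Tendsto (fun τ => cesaroSum K f τ x) atTop (𝓝 (q x))) :
    Tendsto (fun τ => ∫⁻ x, ‖cesaroSum K f τ x - q x‖ₑ ∂σ) atTop (𝓝 0) := by
  have hqm : Measurable q := measurable_of_tendsto_metrizable (measurable_cesaroSum hf)
    (tendsto_pi_nhds.2 hq)
  have hqb : ∀ x, ‖q x‖ₑ ≤ ∑' k, ‖iterMean K f k x‖ₑ := fun x =>
    le_of_tendsto (hq x).enorm (Eventually.of_forall fun τ => enorm_cesaroSum_le τ x)
  have hm := measurable_cesaroSum (K := K) hf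
  have hmi := measurable_iterMean (K := K) hf
  have := tendsto_lintegral_of_dominated_convergence (μ := σ)
    (F := fun τ x => ‖cesaroSum K f τ x - q x‖ₑ) (f := fun _ => 0)
    (fun x => 2 * ∑' k, ‖iterMean K f k x‖ₑ) (fun τ => by fun_prop)
    (fun τ => ae_of_all _ fun x => by
      refine (enorm_sub_le).trans ?_
      simp only [two_mul]
      exact add_le_add (enorm_cesaroSum_le τ x) (hqb x)) ?_ (ae_of_all _ fun x => ?_)
  · simpa using this
  · rw [lintegral_const_mul _ (Measurable.tsum fun k => (hmi k).enorm),
      lintegral_tsum fun k => (hmi k).enorm.aemeasurable]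
    exact ENNReal.mul_ne_top (by simp) hσ
  · have h1 := ((hq x).sub_const (q x)).enorm
    simpa using h1

/-- If the iterated conditional expectations are summable, then their averages vanish. -/
lemma ae_tendsto_average_iterMean (hf : Measurable f) {σ : Measure E}
    (hσ : ∑' k, ∫⁻ x, ‖iterMean K f k x‖ₑ ∂σ ≠ ⊤) :
    ∀ᵐ x ∂σ, Tendsto (fun τ : ℕ => (1 / (τ : ℝ)) * ∑ t ∈ Finset.Icc 1 τ, iterMean K f t x)
      atTop (𝓝 0) := by
  have hmi := measurable_iterMean (K := K) hf
  rw [← lintegral_tsum fun k => (hmi k).enorm.aemeasurable] at hσ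
  filter_upwards [ae_lt_top (Measurable.tsum fun k => (hmi k).enorm) hσ] with x hx
  have hs : Summable fun k => |iterMean K f k x| := tsum_enorm_ne_top_iff_summable_norm.1 hx.ne
  have h0 : Tendsto (fun τ : ℕ => (1 / (τ : ℝ)) * ∑' k, |iterMean K f k x|) atTop (𝓝 0) := by
    simpa using tendsto_one_div_atTop_nhds_zero_nat.mul_const (∑' k, |iterMean K f k x|)
  refine squeeze_zero_norm (fun τ => ?_) h0
  rw [Real.norm_eq_abs, abs_mul, abs_of_nonneg (by positivity)]
  gcongr
  exact (Finset.abs_sum_le_sum_abs _ _).trans (hs.sum_le_tsum _ fun k _ => abs_nonneg _)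

variable [IsMarkovKernel K] {b : ℝ}

lemma abs_iterMean_le (hb : ∀ x, |f x| ≤ b) (k : ℕ) (x : E) : |iterMean K f k x| ≤ b := by
  have := isMarkovKernel_pow K k
  exact abs_integral_le_of_abs_le _ hb

lemma iterMean_add (hf : Measurable f) (hb : ∀ x, |f x| ≤ b) (k t : ℕ) (x : E) :
    iterMean K f (k + t) x = ∫ y, iterMean K f k y ∂((K ^ t) x) := by
  have := isMarkovKernel_pow K (k + t)
  have h : (K ^ (k + t)) = (K ^ k) ∘ₖ (K ^ t) := Kernel.pow_add K k t
  have hint : Integrable f (((K ^ k) ∘ₖ (K ^ t)) x) := by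
    rw [← h]; exact integrable_of_abs_le hf hb
  rw [iterMean, h, Kernel.integral_comp hint]
  rfl

lemma integral_iterMean {ν : Measure E} [IsProbabilityMeasure ν] (hν : Kernel.Invariant K ν)
    (hf : Measurable f) (hb : ∀ x, |f x| ≤ b) (k : ℕ) :
    ∫ x, iterMean K f k x ∂ν = ∫ x, f x ∂ν := by
  induction k with
  | zero => rw [iterMean_zero hf]
  | succ k ih =>
    have h := integral_bind_kernel ν K (f := iterMean K f k) (by
      rw [hν.def]; exact integrable_of_abs_le (measurable_iterMean hf k) (abs_iterMean_le hb k))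
    rw [hν.def, ih] at h
    rw [h]
    simp only [iterMean_add hf hb k 1, pow_one]

lemma exists_abs_cesaroSum_le (hb : ∀ x, |f x| ≤ b) (τ : ℕ) :
    ∃ b', ∀ x, |cesaroSum K f τ x| ≤ b' := by
  refine ⟨(1 / (τ : ℝ)) * ∑ t ∈ Finset.Icc 1 τ, ∑ k ∈ Finset.range t, b, fun x => ?_⟩
  rw [cesaroSum, abs_mul, abs_of_nonneg (by positivity)]
  gcongr
  refine (Finset.abs_sum_le_sum_abs _ _).trans (Finset.sum_le_sum fun t _ => ?_)
  exact (Finset.abs_sum_le_sum_abs _ _).trans (Finset.sum_le_sum fun k _ => abs_iterMean_le hb k x)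

/-- The Cesàro sums solve the Poisson equation up to a small remainder. -/
lemma add_integral_cesaroSum_sub (hf : Measurable f) (hb : ∀ x, |f x| ≤ b) {τ : ℕ} (hτ : 0 < τ)
    (x : E) : f x + (∫ y, cesaroSum K f τ y ∂(K x) - cesaroSum K f τ x) =
      (1 / (τ : ℝ)) * ∑ t ∈ Finset.Icc 1 τ, iterMean K f t x := by
  have hi : ∀ k, Integrable (iterMean K f k) (K x) := fun k =>
    integrable_of_abs_le (measurable_iterMean hf k) (abs_iterMean_le hb k)
  have h1 : ∫ y, cesaroSum K f τ y ∂(K x) =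
      (1 / (τ : ℝ)) * ∑ t ∈ Finset.Icc 1 τ, ∑ k ∈ Finset.range t, iterMean K f (k + 1) x := by
    simp only [cesaroSum]
    rw [integral_const_mul, integral_finsetSum _ fun t _ => integrable_finsetSum _ fun k _ => hi k]
    congr 1
    refine Finset.sum_congr rfl fun t _ => ?_
    rw [integral_finsetSum _ fun k _ => hi k]
    refine Finset.sum_congr rfl fun k _ => ?_
    rw [iterMean_add hf hb k 1, pow_one]
  rw [h1, cesaroSum, ← mul_sub, ← Finset.sum_sub_distrib]
  have h2 : ∀ t, ∑ k ∈ Finset.range t, iterMean K f (k + 1) x -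
      ∑ k ∈ Finset.range t, iterMean K f k x = iterMean K f t x - f x := fun t => by
    rw [← Finset.sum_sub_distrib, Finset.sum_range_sub fun k => iterMean K f k x, iterMean_zero hf]
  simp only [h2, Finset.sum_sub_distrib, Finset.sum_const, Nat.card_Icc, nsmul_eq_mul]
  have hτ' : (τ : ℝ) ≠ 0 := by positivity
  push_cast [Nat.add_sub_cancel]
  field_simp
  ring

end Iterates

section Contraction

variable {E : Type*} [MeasurableSpace E] {K : Kernel E E} [IsMarkovKernel K] {f : E → ℝ} {b : ℝ}
  {ρ ν : Measure E} [IsProbabilityMeasure ρ] {C : ℝ} {abar : ℕ → ℝ}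

/-- A contraction in mean square makes the iterated conditional expectations of a centered function
summable in mean square. -/
lemma tsum_eLpNorm_iterMean_ne_top [IsProbabilityMeasure ν] (hν : Kernel.Invariant K ν) (hC : 0 < C)
    (habar_pos : ∀ t, 0 < abar t) (habar : Tendsto abar atTop (𝓝 0))
    (hcontr : ∀ t : ℕ, 1 ≤ t → ∀ f : E → ℝ, Measurable f → MemLp f 2 ρ →
      eLpNorm (fun x => ∫ y, f y ∂((K ^ t) x) - ∫ y, f y ∂ν) 2 ρ ≤
        ENNReal.ofReal (C * abar t) * eLpNorm f 2 ρ)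
    (hf : Measurable f) (hb : ∀ x, |f x| ≤ b) (hf0 : ∫ x, f x ∂ν = 0) :
    ∑' k, eLpNorm (iterMean K f k) 2 ρ ≠ ⊤ := by
  have hmem : ∀ k, MemLp (iterMean K f k) 2 ρ := fun k =>
    MemLp.of_bound (measurable_iterMean hf k).aestronglyMeasurable b
      (ae_of_all _ fun x => abs_iterMean_le hb k x)
  obtain ⟨t, ht1, ht⟩ : ∃ t, 1 ≤ t ∧ C * abar t ≤ 1 / 2 := by
    have h1 : ∀ᶠ t in atTop, C * abar t < 1 / 2 := by
      have := habar.const_mul C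
      rw [mul_zero] at this
      exact this.eventually_lt_const (by norm_num)
    obtain ⟨t, h2, h3⟩ := ((eventually_ge_atTop 1).and h1).exists
    exact ⟨t, h2, h3.le⟩
  have hs : Summable fun k => (eLpNorm (iterMean K f k) 2 ρ).toReal := by
    refine summable_of_le_half (t := t) (fun k => ENNReal.toReal_nonneg) fun k => ?_
    have h1 := hcontr t ht1 _ (measurable_iterMean hf k) (hmem k)
    rw [integral_iterMean hν hf hb, hf0] at h1
    simp only [sub_zero, ← iterMean_add hf hb k t] at h1
    have h2 := ENNReal.toReal_mono
      (ENNReal.mul_ne_top ENNReal.ofReal_ne_top (hmem k).eLpNorm_ne_top) h1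
    rw [ENNReal.toReal_mul, ENNReal.toReal_ofReal (mul_pos hC (habar_pos t)).le] at h2
    refine h2.trans ?_
    gcongr
  have h1 : ∀ k, eLpNorm (iterMean K f k) 2 ρ =
      ENNReal.ofReal (eLpNorm (iterMean K f k) 2 ρ).toReal := fun k =>
    (ENNReal.ofReal_toReal (hmem k).eLpNorm_ne_top).symm
  rw [tsum_congr h1]
  exact hs.tsum_ofReal_ne_top

lemma lintegral_enorm_le_eLpNorm_two {g : E → ℝ} (hg : Measurable g) :
    ∫⁻ x, ‖g x‖ₑ ∂ρ ≤ eLpNorm g 2 ρ := by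
  rw [← eLpNorm_one_eq_lintegral_enorm]
  exact eLpNorm_le_eLpNorm_of_exponent_le (by norm_num) hg.aestronglyMeasurable

/-- A one-step bound for the law of the chain after one step. -/
lemma lintegral_bind_enorm_le {D W : ℝ≥0∞}
    (hcontr : ∀ f : E → ℝ, Measurable f → MemLp f 2 ρ →
      eLpNorm (fun x => ∫ y, f y ∂(K x) - ∫ y, f y ∂ν) 2 ρ ≤ D * eLpNorm f 2 ρ)
    (hdom : ∀ f : E → ℝ≥0∞, Measurable f → ∫⁻ x, f x ∂ν ≤ W * ∫⁻ x, f x ∂ρ)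
    {g : E → ℝ} (hg : Measurable g) (hb : ∀ x, |g x| ≤ b) :
    ∫⁻ x, ‖g x‖ₑ ∂(ρ.bind K) ≤ (D + W) * eLpNorm g 2 ρ := by
  have hga : Measurable fun x => |g x| := by fun_prop
  have hgb : ∀ x, |(|g x|)| ≤ b := fun x => by rw [abs_abs]; exact hb x
  have hmem : MemLp (fun x => |g x|) 2 ρ := MemLp.of_bound hga.aestronglyMeasurable b
    (ae_of_all _ hgb)
  have hnorm : eLpNorm (fun x => |g x|) 2 ρ = eLpNorm g 2 ρ := eLpNorm_norm g
  have hKm := measurable_integral_kernel K hga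
  rw [Measure.lintegral_bind (Kernel.aemeasurable _) hg.enorm.aemeasurable]
  have h1 : ∀ x, ∫⁻ y, ‖g y‖ₑ ∂(K x) ≤
      ‖∫ y, |g y| ∂(K x) - ∫ y, |g y| ∂ν‖ₑ + ‖∫ y, |g y| ∂ν‖ₑ := fun x => by
    have h2 : ∫⁻ y, ‖g y‖ₑ ∂(K x) = ‖∫ y, |g y| ∂(K x)‖ₑ := by
      rw [Real.enorm_of_nonneg (integral_nonneg fun y => abs_nonneg _),
        ofReal_integral_eq_lintegral_ofReal (integrable_of_abs_le hga hgb)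
          (ae_of_all _ fun y => abs_nonneg _)]
      simp only [Real.enorm_eq_ofReal_abs]
    rw [h2]
    calc ‖∫ y, |g y| ∂(K x)‖ₑ
        = ‖(∫ y, |g y| ∂(K x) - ∫ y, |g y| ∂ν) + ∫ y, |g y| ∂ν‖ₑ := by rw [sub_add_cancel]
      _ ≤ _ := enorm_add_le _ _
  refine (lintegral_mono h1).trans ?_
  rw [lintegral_add_right _ measurable_const, add_mul]
  refine add_le_add ?_ ?_
  · refine (lintegral_enorm_le_eLpNorm_two (hKm.sub_const _)).trans ?_
    rw [← hnorm]
    exact hcontr _ hga hmem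
  · rw [lintegral_const, measure_univ, mul_one]
    refine (enorm_integral_le_lintegral_enorm _).trans ((hdom _ hga.enorm).trans ?_)
    gcongr
    rw [← hnorm]
    exact lintegral_enorm_le_eLpNorm_two hga

end Contraction

section Population

variable {S A : Type*} [MeasurableSpace S] [MeasurableSpace A] [Fintype A]
  [MeasurableSingletonClass A] {P : Kernel (S × A) S} [IsMarkovKernel P] {π : Kernel S A}
  [IsMarkovKernel π] {ρ : Measure (S × A)} [IsProbabilityMeasure ρ]

lemma lintegral_enorm_weightedTd_zero_le {e f : S × A → ℝ} {bG : ℝ} (he : ∀ x, |e x| ≤ bG)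
    (hf : Measurable f) :
    ∫⁻ z, ‖weightedTd π (fun _ => 0) e f z‖ₑ ∂(ρ ⊗ₘ P) ≤
      ENNReal.ofReal bG * (∫⁻ y, ‖f y‖ₑ ∂(ρ.bind (pairKernel P π)) + ∫⁻ y, ‖f y‖ₑ ∂ρ) := by
  have hm := measurable_policyMean (π := π) hf
  have hfst : ∫⁻ z, ‖f z.1‖ₑ ∂(ρ ⊗ₘ P) = ∫⁻ y, ‖f y‖ₑ ∂ρ := by
    rw [Measure.lintegral_compProd (by fun_prop)]
    simp
  calc ∫⁻ z, ‖weightedTd π (fun _ => 0) e f z‖ₑ ∂(ρ ⊗ₘ P)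
      ≤ ∫⁻ z, ENNReal.ofReal bG * (‖policyMean π f z.2‖ₑ + ‖f z.1‖ₑ) ∂(ρ ⊗ₘ P) := by
        refine lintegral_mono fun z => ?_
        rw [weightedTd, zero_add, enorm_mul, valueDiff, Real.enorm_eq_ofReal_abs]
        gcongr
        · exact he _
        · exact enorm_sub_le
    _ = ENNReal.ofReal bG * (∫⁻ z, ‖policyMean π f z.2‖ₑ ∂(ρ ⊗ₘ P) + ∫⁻ y, ‖f y‖ₑ ∂ρ) := by
        rw [lintegral_const_mul _ (by fun_prop), lintegral_add_left (by fun_prop), hfst]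
    _ ≤ _ := by
        gcongr
        exact lintegral_enorm_policyMean_le ρ hf

/-- The relative value function solves the Bellman equation: the weighted temporal difference has
mean zero for every choice of the weights. -/
lemma integral_weightedTd_relativeValue {h : S → ℝ} (hh : Measurable h) {bh : ℝ}
    (hbh : ∀ s, |h s| ≤ bh) {e Q : S × A → ℝ} (he : Measurable e) {bG : ℝ} (hbG : ∀ x, |e x| ≤ bG)
    (hQ : ∀ x, Tendsto (fun τ => cesaroSum (pairKernel P π) (fun y => h y.1) τ x) atTop (𝓝 (Q x)))
    (hs : ∑' k, ∫⁻ x, ‖iterMean (pairKernel P π) (fun y => h y.1) k x‖ₑ ∂ρ ≠ ⊤)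
    (hs' : ∑' k, ∫⁻ x, ‖iterMean (pairKernel P π) (fun y => h y.1) k x‖ₑ
      ∂(ρ.bind (pairKernel P π)) ≠ ⊤) :
    Integrable (weightedTd π h e Q) (ρ ⊗ₘ P) ∧
      ∫ z, weightedTd π h e Q z ∂(ρ ⊗ₘ P) = 0 := by
  set K := pairKernel P π with hK
  set f : S × A → ℝ := fun y => h y.1 with hf
  have hfm : Measurable f := by fun_prop
  have hfb : ∀ x, |f x| ≤ bh := fun x => hbh _
  have hqm := measurable_cesaroSum (K := K) hfm
  have hQm : Measurable Q := measurable_of_tendsto_metrizable hqm (tendsto_pi_nhds.2 hQ)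
  have hsub : ∀ τ z, weightedTd π h e (cesaroSum K f τ) z - weightedTd π h e Q z =
      weightedTd π (fun _ => 0) e (fun x => cesaroSum K f τ x - Q x) z := fun τ z => by
    simp only [weightedTd, ← valueDiff_sub]; ring
  have hlim : Tendsto (fun τ => ∫⁻ z, ‖weightedTd π h e (cesaroSum K f τ) z -
      weightedTd π h e Q z‖ₑ ∂(ρ ⊗ₘ P)) atTop (𝓝 0) := by
    have h1 := (tendsto_lintegral_cesaroSum_sub hfm hs' hQ).add
      (tendsto_lintegral_cesaroSum_sub hfm hs hQ)
    have h2 := ENNReal.Tendsto.const_mul (a := ENNReal.ofReal bG) h1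
      (Or.inr ENNReal.ofReal_ne_top)
    rw [add_zero, mul_zero] at h2
    refine tendsto_of_tendsto_of_tendsto_of_le_of_le tendsto_const_nhds h2
      (fun τ => zero_le) fun τ => ?_
    simp only [hsub]
    exact lintegral_enorm_weightedTd_zero_le hbG ((hqm τ).sub hQm)
  have hint : ∀ τ, Integrable (weightedTd π h e (cesaroSum K f τ)) (ρ ⊗ₘ P) := fun τ => by
    obtain ⟨b', hb'⟩ := exists_abs_cesaroSum_le (K := K) hfb τ
    exact integrable_of_abs_le (measurable_weightedTd hh he (hqm τ))
      (abs_weightedTd_le hbh hbG hb')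
  have hQint : Integrable (weightedTd π h e Q) (ρ ⊗ₘ P) := by
    obtain ⟨τ, hτ⟩ := (hlim.eventually_lt_const (ENNReal.zero_lt_top)).exists
    have h1 : Integrable (fun z => weightedTd π h e (cesaroSum K f τ) z - weightedTd π h e Q z)
        (ρ ⊗ₘ P) := ⟨((measurable_weightedTd hh he (hqm τ)).sub
          (measurable_weightedTd hh he hQm)).aestronglyMeasurable, hτ⟩
    exact ((hint τ).sub h1).congr (ae_of_all _ fun z => by simp)
  refine ⟨hQint, ?_⟩
  have hl1 := tendsto_integral_of_L1 _ hQint.aestronglyMeasurable (Eventually.of_forall hint) hlim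
  have hl2 : Tendsto (fun τ => ∫ z, weightedTd π h e (cesaroSum K f τ) z ∂(ρ ⊗ₘ P)) atTop
      (𝓝 0) := by
    have h1 : ∀ᶠ τ : ℕ in atTop, ∫ x, e x * ((1 / (τ : ℝ)) * ∑ t ∈ Finset.Icc 1 τ,
        iterMean K f t x) ∂ρ = ∫ z, weightedTd π h e (cesaroSum K f τ) z ∂(ρ ⊗ₘ P) := by
      filter_upwards [eventually_gt_atTop 0] with τ hτ
      obtain ⟨b', hb'⟩ := exists_abs_cesaroSum_le (K := K) hfb τ
      rw [Measure.integral_compProd (hint τ)]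
      refine integral_congr_ae (ae_of_all _ fun x => ?_)
      simp only
      rw [integral_weightedTd_kernel (hqm τ) hb', ← add_integral_cesaroSum_sub hfm hfb hτ x]
    refine Tendsto.congr' h1 ?_
    have hmi := measurable_iterMean (K := K) hfm
    have h2 := tendsto_integral_of_dominated_convergence (μ := ρ)
      (F := fun (τ : ℕ) x => e x * ((1 / (τ : ℝ)) * ∑ t ∈ Finset.Icc 1 τ, iterMean K f t x))
      (f := fun _ => 0) (fun _ => bG * bh)
      (fun τ => Measurable.aestronglyMeasurable (by fun_prop)) (integrable_const _)
      (fun τ => ae_of_all _ fun x => ?_) ?_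
    · simpa using h2
    · have h3 : |∑ t ∈ Finset.Icc 1 τ, iterMean K f t x| ≤ τ * bh :=
        (Finset.abs_sum_le_sum_abs _ _).trans
          ((Finset.sum_le_sum fun t _ => abs_iterMean_le hfb t x).trans (by simp))
      have h0 : 0 ≤ bh := (abs_nonneg _).trans (hfb x)
      have h4 : |(1 / (τ : ℝ)) * ∑ t ∈ Finset.Icc 1 τ, iterMean K f t x| ≤ bh := by
        rw [abs_mul, abs_of_nonneg (by positivity)]
        rcases Nat.eq_zero_or_pos τ with rfl | hτ
        · simpa using h0
        · have hτ' : (0 : ℝ) < τ := by exact_mod_cast hτ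
          rw [one_div, inv_mul_le_iff₀ hτ']
          exact h3
      rw [Real.norm_eq_abs, abs_mul]
      exact mul_le_mul (hbG x) h4 (abs_nonneg _) ((abs_nonneg _).trans (hbG x))
    · filter_upwards [ae_tendsto_average_iterMean hfm hs] with x hx
      simpa using hx.const_mul (e x)
  exact tendsto_nhds_unique hl1 hl2

end Population

/-! ### The ratio function -/

section Ratio

variable {S A : Type*} [MeasurableSpace S] [MeasurableSpace A] {π : Kernel S A}
  {ρ : Measure (S × A)} {d m : Measure S}

lemma compProd_absolutelyContinuous [Fintype A] [MeasurableSingletonClass A] [SigmaFinite m]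
    (hdm : d ≪ m) {dens : S × A → ℝ≥0∞} (hdens : Measurable dens)
    (hρ : ρ = (m.prod Measure.count).withDensity dens) {pmin : ℝ} (hpmin : 0 < pmin)
    (hdens_min : ∀ x, ENNReal.ofReal pmin ≤ dens x) : d ⊗ₘ π ≪ ρ := by
  have h1 : m.prod (Measure.count : Measure A) ≪ ρ := by
    rw [hρ]
    exact withDensity_absolutelyContinuous' hdens.aemeasurable
      (ae_of_all _ fun x => ((ENNReal.ofReal_pos.2 hpmin).trans_le (hdens_min x)).ne')
  have h2 : d ⊗ₘ π ≪ m ⊗ₘ Kernel.const S (Measure.count : Measure A) :=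
    hdm.compProd (ae_of_all _ fun s C hC => by
      rw [Kernel.const_apply, Measure.count_eq_zero_iff] at hC
      simp [hC])
  rw [Measure.compProd_const] at h2
  exact h2.trans h1

lemma lintegral_compProd_le [IsMarkovKernel π] [IsFiniteMeasure ρ] [IsProbabilityMeasure d] (hac : d ⊗ₘ π ≪ ρ) {W : ℝ}
    (hW : ∀ᵐ x ∂ρ, ratio ρ d π x ≤ W) {f : S × A → ℝ≥0∞} (hf : Measurable f) :
    ∫⁻ x, f x ∂(d ⊗ₘ π) ≤ ENNReal.ofReal W * ∫⁻ x, f x ∂ρ := by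
  rw [← lintegral_rnDeriv_mul hac hf.aemeasurable, ← lintegral_const_mul _ hf]
  refine lintegral_mono_ae ?_
  filter_upwards [hW, Measure.rnDeriv_lt_top (d ⊗ₘ π) ρ] with x hx hx'
  gcongr
  rw [← ENNReal.ofReal_toReal hx'.ne]
  exact ENNReal.ofReal_le_ofReal hx

end Ratio

lemma integral_centeredReward {S : Type*} [MeasurableSpace S] {c : ℝ} {R : S → ℝ} {Rmax : ℝ}
    {d : Measure S} [IsProbabilityMeasure d] (hR : Measurable R) (hRb : ∀ s, |R s| ≤ Rmax)
    (β : ℝ) : ∫ s, centeredReward c R d β s ∂d = 0 := by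
  simp only [centeredReward_eq]
  rw [integral_const_mul, integral_sub (integrable_const _) (integrable_shortfall hR hRb β d)]
  simp

/-! ### Population bounds for the estimation error -/

/-- The estimation error of the objective is the weighted sample average of the temporal
differences. -/
lemma objectiveEstimator_sub_objective {S A : Type*} [MeasurableSpace S]
    [MeasurableSpace A] [Fintype A] {π : Kernel S A} (n T : ℕ) (Z : ℕ → ℕ → (S × A) × S) (c : ℝ) (R : S → ℝ)
    (d : Measure S) (β : ℝ) {e Q : S × A → ℝ} (he : sampleMean n T Z (fun z => e z.1) ≠ 0) :
    objectiveEstimator (sampleMean n T Z) c R β (ratioEstimator (sampleMean n T Z) e)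
        (valueDiff π Q) - objective c R d β =
      (sampleMean n T Z fun z => e z.1)⁻¹ *
        sampleMean n T Z (weightedTd π (centeredReward c R d β) e Q) := by
  set E := sampleMean n T Z fun z => e z.1 with hE
  have h1 : sampleMean n T Z (fun z => ratioEstimator (sampleMean n T Z) e z.1) = 1 := by
    simp only [ratioEstimator, ← hE, div_eq_inv_mul]
    rw [sampleMean_const_mul, ← hE, inv_mul_cancel₀ he]
  have h2 : sampleMean n T Z (fun z => ratioEstimator (sampleMean n T Z) e z.1 *
        (modReward c R β z.1.1 + valueDiff π Q z)) -
      sampleMean n T Z (fun z => objective c R d β * ratioEstimator (sampleMean n T Z) e z.1) =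
      sampleMean n T Z (fun z => E⁻¹ * weightedTd π (centeredReward c R d β) e Q z) := by
    rw [sampleMean_sub]
    congr 1
    funext z
    simp only [ratioEstimator, ← hE, weightedTd, centeredReward]
    ring
  rw [sampleMean_const_mul, sampleMean_const_mul, h1, mul_one] at h2
  rw [objectiveEstimator, h1, div_one]
  exact h2

section Error

variable {S A : Type*} [MeasurableSpace S] [MeasurableSpace A] [Fintype A]
  [MeasurableSingletonClass A] {P : Kernel (S × A) S} [IsMarkovKernel P] {π : Kernel S A}
  [IsMarkovKernel π] {ρ : Measure (S × A)} [IsProbabilityMeasure ρ]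

/-- If weights that annihilate the temporal differences are available, then the weighted temporal
difference is controlled by the error of the weights. -/
lemma enorm_integral_weightedTd_le_weight {h : S → ℝ} (hh : Measurable h) {bh : ℝ}
    (hbh : ∀ s, |h s| ≤ bh) {w w' wbar Q : S × A → ℝ} (hw : Measurable w) {bw : ℝ}
    (hbw : ∀ x, |w x| ≤ bw) (hw' : Measurable w') (hQ : Measurable Q) {bF : ℝ}
    (hbF : ∀ x, |Q x| ≤ bF) (hww : wbar =ᵐ[ρ] w')
    (hint : Integrable (weightedTd π h w' Q) (ρ ⊗ₘ P))
    (h0 : ∫ z, weightedTd π h w' Q z ∂(ρ ⊗ₘ P) = 0) :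
    ‖∫ z, weightedTd π h w Q z ∂(ρ ⊗ₘ P)‖ₑ ≤
      ENNReal.ofReal (bh + 2 * bF) * eLpNorm (w - wbar) 2 ρ := by
  have h1 : ∫ z, weightedTd π h w Q z ∂(ρ ⊗ₘ P) =
      ∫ z, weightedTd π h (fun x => w x - w' x) Q z ∂(ρ ⊗ₘ P) := by
    have h2 : ∫ z, (weightedTd π h w Q z - weightedTd π h w' Q z) ∂(ρ ⊗ₘ P) =
        ∫ z, weightedTd π h w Q z ∂(ρ ⊗ₘ P) := by
      rw [integral_sub (integrable_of_abs_le (measurable_weightedTd hh hw hQ)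
        (abs_weightedTd_le hbh hbw hbF)) hint, h0, sub_zero]
    rw [← h2]
    refine integral_congr_ae (ae_of_all _ fun z => ?_)
    simp only [weightedTd]; ring
  have h3 : eLpNorm (w - wbar) 2 ρ = eLpNorm (fun x => w x - w' x) 2 ρ := by
    refine eLpNorm_congr_ae ?_
    filter_upwards [hww] with x hx
    simp [hx]
  rw [h1, h3]
  refine (enorm_integral_le_lintegral_enorm _).trans ?_
  calc ∫⁻ z, ‖weightedTd π h (fun x => w x - w' x) Q z‖ₑ ∂(ρ ⊗ₘ P)
      ≤ ∫⁻ z, ENNReal.ofReal (bh + 2 * bF) * ‖w z.1 - w' z.1‖ₑ ∂(ρ ⊗ₘ P) := by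
        refine lintegral_mono fun z => ?_
        rw [weightedTd, enorm_mul, mul_comm]
        gcongr
        rw [Real.enorm_eq_ofReal_abs]
        exact ENNReal.ofReal_le_ofReal
          ((abs_add_le _ _).trans (add_le_add (hbh _) (abs_valueDiff_le hbF z)))
    _ = ENNReal.ofReal (bh + 2 * bF) * ∫⁻ x, ‖w x - w' x‖ₑ ∂ρ := by
        rw [lintegral_const_mul _ (by fun_prop), Measure.lintegral_compProd (by fun_prop)]
        simp
    _ ≤ _ := by
        gcongr
        exact lintegral_enorm_le_eLpNorm_two (hw.sub hw')

/-- If the temporal difference of `Q` has conditional mean zero, then the weighted temporal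
difference of `Q'` is controlled by its error. -/
lemma enorm_integral_weightedTd_le_valueDiff {h : S → ℝ} (hh : Measurable h) {bh : ℝ}
    (hbh : ∀ s, |h s| ≤ bh) {e Q Q' : S × A → ℝ} (he : Measurable e) {bG : ℝ}
    (hbG : ∀ x, |e x| ≤ bG) (hQ : Measurable Q) (hQ' : Measurable Q') {bF : ℝ}
    (hbF : ∀ x, |Q' x| ≤ bF) {Ubar : (S × A) × S → ℝ} (hU : Ubar =ᵐ[ρ ⊗ₘ P] valueDiff π Q)
    (hint : Integrable (weightedTd π h e Q) (ρ ⊗ₘ P))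
    (h0 : ∫ z, weightedTd π h e Q z ∂(ρ ⊗ₘ P) = 0) :
    ‖∫ z, weightedTd π h e Q' z ∂(ρ ⊗ₘ P)‖ₑ ≤
      ENNReal.ofReal bG * eLpNorm (valueDiff π Q' - Ubar) 2 (ρ ⊗ₘ P) := by
  have hm := (measurable_valueDiff (π := π) hQ').sub (measurable_valueDiff (π := π) hQ)
  have h1 : ∫ z, weightedTd π h e Q' z ∂(ρ ⊗ₘ P) =
      ∫ z, e z.1 * (valueDiff π Q' z - valueDiff π Q z) ∂(ρ ⊗ₘ P) := by
    have h2 : ∫ z, (weightedTd π h e Q' z - weightedTd π h e Q z) ∂(ρ ⊗ₘ P) =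
        ∫ z, weightedTd π h e Q' z ∂(ρ ⊗ₘ P) := by
      rw [integral_sub (integrable_of_abs_le (measurable_weightedTd hh he hQ')
        (abs_weightedTd_le hbh hbG hbF)) hint, h0, sub_zero]
    rw [← h2]
    refine integral_congr_ae (ae_of_all _ fun z => ?_)
    simp only [weightedTd]; ring
  have h3 : eLpNorm (valueDiff π Q' - Ubar) 2 (ρ ⊗ₘ P) =
      eLpNorm (valueDiff π Q' - valueDiff π Q) 2 (ρ ⊗ₘ P) := by
    refine eLpNorm_congr_ae ?_
    filter_upwards [hU] with x hx
    simp [hx]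
  rw [h1, h3]
  refine (enorm_integral_le_lintegral_enorm _).trans ?_
  calc ∫⁻ z, ‖e z.1 * (valueDiff π Q' z - valueDiff π Q z)‖ₑ ∂(ρ ⊗ₘ P)
      ≤ ∫⁻ z, ENNReal.ofReal bG * ‖(valueDiff π Q' - valueDiff π Q) z‖ₑ ∂(ρ ⊗ₘ P) := by
        refine lintegral_mono fun z => ?_
        rw [enorm_mul]
        gcongr
        · rw [Real.enorm_eq_ofReal_abs]
          exact ENNReal.ofReal_le_ofReal (hbG _)
        · rfl
    _ = ENNReal.ofReal bG * ∫⁻ z, ‖(valueDiff π Q' - valueDiff π Q) z‖ₑ ∂(ρ ⊗ₘ P) := by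
        rw [lintegral_const_mul _ hm.enorm]
    _ ≤ _ := by
        gcongr
        exact lintegral_enorm_le_eLpNorm_two hm

end Error

/-! ### Consistency -/

/-- Consistency of a normalized average `a⁻¹ s`: it suffices that `a` is bounded away from zero in
probability, that `s` is close to `p`, and that `a⁻¹ p` is controlled by a vanishing quantity. -/
lemma tendsto_measure_exists_ge {Ω ι : Type*} [MeasurableSpace Ω] {Pr : Measure Ω} {a : ℕ → Ω → ℝ}
    {x s p : ℕ → ι → Ω → ℝ} {B : Set ι} (hx : ∀ k β ω, a k ω ≠ 0 → x k β ω = (a k ω)⁻¹ * s k β ω)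
    (ha : ∀ δ : ℝ≥0∞, 0 < δ → ∃ κ : ℝ, 0 < κ ∧ ∀ᶠ k in atTop, Pr {ω | |a k ω| < κ} ≤ δ)
    (hs : ∀ ε : ℝ, 0 < ε →
      Tendsto (fun k => Pr {ω | ∃ β, ε ≤ |s k β ω - p k β ω|}) atTop (𝓝 0))
    {V : ℕ → Ω → ℝ≥0∞}
    (hV : ∀ ε : ℝ≥0∞, 0 < ε → Tendsto (fun k => Pr {ω | ε ≤ V k ω}) atTop (𝓝 0))
    (hp : ∀ κ : ℝ, 0 < κ → ∃ L : ℝ, 0 < L ∧ ∀ k ω, κ ≤ |a k ω| → ∀ β ∈ B,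
      ‖(a k ω)⁻¹ * p k β ω‖ₑ ≤ ENNReal.ofReal L * V k ω) {ε : ℝ} (hε : 0 < ε) :
    Tendsto (fun k => Pr {ω | ∃ β ∈ B, ε ≤ |x k β ω|}) atTop (𝓝 0) := by
  refine ENNReal.tendsto_nhds_zero.2 fun δ hδ => ?_
  have hδ3 : 0 < δ / 3 := ENNReal.div_pos hδ.ne' (by simp)
  obtain ⟨κ, hκ, hk1⟩ := ha _ hδ3
  obtain ⟨L, hL, hk2⟩ := hp κ hκ
  have hk3 := ENNReal.tendsto_nhds_zero.1 (hs (ε / 2 * κ) (by positivity)) _ hδ3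
  have hk4 := ENNReal.tendsto_nhds_zero.1
    (hV (ENNReal.ofReal (ε / 2 / L)) (ENNReal.ofReal_pos.2 (by positivity))) _ hδ3
  filter_upwards [hk1, hk3, hk4] with k h1 h3 h4
  have hsub : {ω | ∃ β ∈ B, ε ≤ |x k β ω|} ⊆ {ω | |a k ω| < κ} ∪
      ({ω | ∃ β, ε / 2 * κ ≤ |s k β ω - p k β ω|} ∪
        {ω | ENNReal.ofReal (ε / 2 / L) ≤ V k ω}) := by
    rintro ω ⟨β, hβ, hge⟩
    by_contra hcon
    simp only [Set.mem_union, Set.mem_ofPred_eq, not_or, not_lt, not_exists, not_le] at hcon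
    obtain ⟨c1, c2, c3⟩ := hcon
    have ha0 : 0 < |a k ω| := hκ.trans_le c1
    have e1 : |(a k ω)⁻¹ * (s k β ω - p k β ω)| < ε / 2 := by
      rw [abs_mul, abs_inv, inv_mul_lt_iff₀ ha0]
      calc _ < ε / 2 * κ := c2 β
        _ ≤ ε / 2 * |a k ω| := by gcongr
        _ = _ := by ring
    have e2 : |(a k ω)⁻¹ * p k β ω| ≤ ε / 2 := by
      have h5 := (hk2 k ω c1 β hβ).trans (mul_le_mul_right c3.le _)
      rw [← ENNReal.ofReal_mul hL.le, mul_div_cancel₀ _ hL.ne', Real.enorm_eq_ofReal_abs] at h5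
      exact (ENNReal.ofReal_le_ofReal_iff (by positivity)).1 h5
    have e3 : x k β ω = (a k ω)⁻¹ * (s k β ω - p k β ω) + (a k ω)⁻¹ * p k β ω := by
      rw [hx k β ω (abs_pos.1 ha0)]; ring
    have e4 := abs_add_le ((a k ω)⁻¹ * (s k β ω - p k β ω)) ((a k ω)⁻¹ * p k β ω)
    rw [← e3] at e4
    linarith
  calc _ ≤ _ := measure_mono hsub
    _ ≤ δ / 3 + (δ / 3 + δ / 3) :=
        (measure_union_le _ _).trans (add_le_add h1 ((measure_union_le _ _).trans
          (add_le_add h3 h4)))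
    _ = δ := by rw [← add_assoc, ENNReal.add_thirds]

/-- Uniform closeness of a family of functions to a function with a maximum yields closeness of the
suprema. -/
lemma exists_isLUB_of_forall_abs_sub_lt {ι : Type*} {f g : ι → ℝ} {i₀ : ι} (hg : ∀ i, g i ≤ g i₀)
    {ε : ℝ} (hε : 0 < ε) (h : ∀ i, |f i - g i| < ε / 2) :
    ∃ b, IsLUB (Set.range f) b ∧ |b - g i₀| < ε := by
  have hub : ∀ y ∈ Set.range f, y ≤ g i₀ + ε / 2 := by
    rintro _ ⟨i, rfl⟩
    linarith [hg i, (abs_lt.1 (h i)).2]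
  have hlub := isLUB_csSup (⟨f i₀, i₀, rfl⟩ : (Set.range f).Nonempty) ⟨_, hub⟩
  refine ⟨_, hlub, ?_⟩
  have h1 := hlub.2 hub
  have h2 := hlub.1 ⟨i₀, rfl⟩
  have h3 := (abs_lt.1 (h i₀)).1
  rw [abs_lt]
  constructor <;> linarith

/-- A deterministic bound for the penalties, and its order. -/
lemma exists_penalty_bound {α : ℝ} (hα0 : 0 < α) (hα1 : α < 1) {N : ℕ → ℕ}
    (hN : Tendsto N atTop atTop) {lam mu : ℕ → ℝ} (hlam : HasTuningRate α N lam)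
    (hmu : HasTuningRate α N mu) {u v p q : ℝ} (hu : 0 ≤ u) (hv : 0 ≤ v) (hp : 0 ≤ p)
    (hq : 0 ≤ q) :
    ∃ (M : ℕ → ℝ) (D : ℝ), ∀ᶠ k in atTop, 0 < lam k ∧ 0 < mu k ∧ 0 < M k ∧
      M k ^ (2 * α) ≤ D * (N k : ℝ) ^ (1 / 2 : ℝ) ∧
      u / lam k + p ≤ M k ^ 2 ∧ v / mu k + q ≤ M k ^ 2 := by
  obtain ⟨D₁, hD₁, h1⟩ := hlam.exists_inv_le hα0 hN
  obtain ⟨D₂, hD₂, h2⟩ := hmu.exists_inv_le hα0 hN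
  set D := u * D₁ + p + v * D₂ + q + 1 with hD
  have hD0 : 0 < D := by positivity
  refine ⟨fun k => Real.sqrt (D * (N k : ℝ) ^ (1 / (1 + α))), D ^ α, ?_⟩
  filter_upwards [h1, h2, hN.eventually_ge_atTop 1] with k hk1 hk2 hNk
  have hN1 : (1 : ℝ) ≤ N k := by exact_mod_cast hNk
  have hN0 : (0 : ℝ) < N k := by linarith
  have hNp : 1 ≤ (N k : ℝ) ^ (1 / (1 + α)) := Real.one_le_rpow hN1 (by positivity)
  set Y := (N k : ℝ) ^ (1 / (1 + α)) with hY
  have hY0 : 0 < Y := by linarith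
  refine ⟨hk1.1, hk2.1, by positivity, ?_, ?_, ?_⟩
  · rw [Real.sqrt_eq_rpow, ← Real.rpow_mul (by positivity),
      show 1 / 2 * (2 * α) = α by ring, Real.mul_rpow hD0.le hY0.le, hY, ← Real.rpow_mul hN0.le]
    gcongr
    rw [one_div, inv_mul_le_iff₀ (by positivity)]
    linarith
  all_goals rw [Real.sq_sqrt (by positivity)]
  · calc u / lam k + p = u * (1 / lam k) + p * 1 := by ring
      _ ≤ u * (D₁ * Y) + p * Y := by gcongr; exact hk1.2
      _ = (u * D₁ + p) * Y := by ring
      _ ≤ D * Y := by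
        gcongr
        have : 0 ≤ v * D₂ := by positivity
        linarith
  · calc v / mu k + q = v * (1 / mu k) + q * 1 := by ring
      _ ≤ v * (D₂ * Y) + q * Y := by gcongr; exact hk2.2
      _ = (v * D₂ + q) * Y := by ring
      _ ≤ D * Y := by
        gcongr
        have : 0 ≤ u * D₁ := by positivity
        linarith

lemma IsScaledRatioEstimator.mem {S A : Type*} [MeasurableSpace S] [MeasurableSpace A] [Fintype A]
    {E : ((S × A) × S → ℝ) → ℝ} {π : Kernel S A} {F G : Set (S × A → ℝ)}
    {J₁ J₂ : (S × A → ℝ) → ℝ≥0} {lam mu : ℝ} {eh : S × A → ℝ}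
    (h : IsScaledRatioEstimator E π F G J₁ J₂ lam mu eh) : eh ∈ G := by
  obtain ⟨hh, Hh, h1, h2, -, rfl⟩ := h
  exact (h1 Hh h2).1

lemma IsValueEstimator.mem {S A : Type*} [MeasurableSpace S] [MeasurableSpace A] [Fintype A]
    {E : ((S × A) × S → ℝ) → ℝ} {π : Kernel S A} {c : ℝ} {R : S → ℝ} {F G : Set (S × A → ℝ)}
    {J₁ J₂ : (S × A → ℝ) → ℝ≥0} {lam mu β : ℝ} {Qh : S × A → ℝ}
    (h : IsValueEstimator E π c R F G J₁ J₂ lam mu β Qh) : Qh ∈ F := by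
  obtain ⟨gh, ηh, -, h2, -⟩ := h
  exact h2

end AvgMDP

end

theorem corollary1
    {S A Ω : Type*} [MeasurableSpace S] [MeasurableSpace A] [Fintype A]
    [MeasurableSingletonClass A] [MeasurableSpace Ω]
    -- the decision process, the bounded reward and the robustness level
    (P : Kernel (S × A) S) [IsMarkovKernel P]
    (R : S → ℝ) (hR : Measurable R) (Rmax : ℝ) (hRmax : 0 < Rmax) (hRb : ∀ s, |R s| ≤ Rmax)
    (c : ℝ) (hc0 : 0 ≤ c) (hc1 : c < 1)
    -- the target policy, its stationary law, which has a density, and its relative value functions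
    (π : Kernel S A) [IsMarkovKernel π]
    (m : Measure S) [SigmaFinite m]
    (d : Measure S) [IsProbabilityMeasure d]
    (hd : Kernel.Invariant (AvgMDP.stateKernel P π) d) (hdm : d ≪ m)
    (Q : ℝ → S × A → ℝ) (hQ : ∀ β, AvgMDP.IsRelativeValue P π c R d β (Q β))
    -- the data: i.i.d. trajectories under a behavior policy, stationary, exponentially β-mixing,
    -- with a state-action density that is bounded away from zero
    (Pr : Measure Ω) [IsProbabilityMeasure Pr]
    (πb : Kernel S A) [IsMarkovKernel πb]
    (ρ : Measure (S × A)) [IsProbabilityMeasure ρ]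
    (X : ℕ → ℕ → Ω → S × A)
    (hchain : ∀ i, AvgMDP.IsMarkovChain Pr (AvgMDP.pairKernel P πb) ρ (X i))
    (hindep : iIndepFun (fun i ω t => X i t ω) Pr)
    (hstat : Kernel.Invariant (AvgMDP.pairKernel P πb) ρ)
    (b₀ b₁ : ℝ) (hb₀ : 0 ≤ b₀) (hb₁ : 0 < b₁)
    (hmix : ∀ i, AvgMDP.IsExpBetaMixing Pr (X i) b₀ b₁)
    (dens : S × A → ℝ≥0∞) (hdens : Measurable dens)
    (hρ : ρ = (m.prod Measure.count).withDensity dens)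
    (pmin : ℝ) (hpmin : 0 < pmin) (hdens_min : ∀ x, ENNReal.ofReal pmin ≤ dens x)
    -- mixing of the target chain in the norm of the data, and boundedness of the ratio function
    (C₃ : ℝ) (hC₃ : 0 < C₃) (abar : ℕ → ℝ) (habar_pos : ∀ t, 0 < abar t)
    (habar : Tendsto abar atTop (𝓝 0))
    (hcontr : ∀ t : ℕ, 1 ≤ t → ∀ f : S × A → ℝ, Measurable f → MemLp f 2 ρ →
      eLpNorm (fun x => ∫ y, f y ∂((AvgMDP.pairKernel P π ^ t) x) - ∫ y, f y ∂(d ⊗ₘ π)) 2 ρ ≤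
        ENNReal.ofReal (C₃ * abar t) * eLpNorm f 2 ρ)
    (W : ℝ) (hW : ∀ᵐ x ∂ρ, AvgMDP.ratio ρ d π x ≤ W)
    -- function classes and penalties for the nuisance estimators
    (F₁ G₁ F₂ G₂ : Set (S × A → ℝ)) (J₁ J₂ : (S × A → ℝ) → ℝ≥0)
    (Fmax Gmax C₄ α : ℝ) (hC₄ : 0 < C₄) (hα0 : 0 < α) (hα1 : α < 1)
    (hF₁ : AvgMDP.IsFunctionClass F₁ J₁ Fmax C₄ α) (hG₁ : AvgMDP.IsFunctionClass G₁ J₂ Gmax C₄ α)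
    (hF₂ : AvgMDP.IsFunctionClass F₂ J₁ Fmax C₄ α) (hG₂ : AvgMDP.IsFunctionClass G₂ J₂ Gmax C₄ α)
    -- sample sizes and horizons with `N = n T → ∞`, and tuning parameters
    (n T : ℕ → ℕ) (hn : ∀ k, 0 < n k) (hT : ∀ k, 0 < T k)
    (hN : Tendsto (fun k => n k * T k) atTop atTop)
    (lam₁ mu₁ lam₂ mu₂ : ℕ → ℝ)
    (hlam₁ : AvgMDP.HasTuningRate α (fun k => n k * T k) lam₁)
    (hmu₁ : AvgMDP.HasTuningRate α (fun k => n k * T k) mu₁)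
    (hlam₂ : AvgMDP.HasTuningRate α (fun k => n k * T k) lam₂)
    (hmu₂ : AvgMDP.HasTuningRate α (fun k => n k * T k) mu₂)
    -- the sample averages, the nuisance estimators and the estimator of the objective
    (E : ℕ → Ω → ((S × A) × S → ℝ) → ℝ)
    (hE : E = fun k ω => AvgMDP.sampleMean (n k) (T k) (AvgMDP.transition X ω))
    (Qh : ℕ → ℝ → Ω → S × A → ℝ)
    (hQh : ∀ k β ω, AvgMDP.IsValueEstimator (E k ω) π c R F₁ G₁ J₁ J₂ (lam₁ k) (mu₁ k) β
      (Qh k β ω))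
    (eh : ℕ → Ω → S × A → ℝ)
    (heh : ∀ k ω, AvgMDP.IsScaledRatioEstimator (E k ω) π F₂ G₂ J₁ J₂ (lam₂ k) (mu₂ k) (eh k ω))
    (Uh : ℕ → ℝ → Ω → (S × A) × S → ℝ)
    (hUh : Uh = fun k β ω => AvgMDP.valueDiff π (Qh k β ω))
    (wh : ℕ → Ω → S × A → ℝ)
    (hwh : wh = fun k ω => AvgMDP.ratioEstimator (E k ω) (eh k ω))
    (Mh : ℕ → ℝ → Ω → ℝ)
    (hMh : Mh = fun k β ω => AvgMDP.objectiveEstimator (E k ω) c R β (wh k ω) (Uh k β ω))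
    -- the normalizing constant of the ratio estimator is bounded away from zero in probability
    (hnorm : ∀ δ : ℝ≥0∞, 0 < δ → ∃ κ : ℝ, 0 < κ ∧ ∀ᶠ k in atTop,
      Pr {ω | |E k ω (fun z => eh k ω z.1)| < κ} ≤ δ)
    -- the limit of the ratio estimator; by stationarity, every transition tuple in the data has
    -- the law `ρ ⊗ₘ P`, and the norm is the `L²` norm of that law
    (wbar : S × A → ℝ) (hwbar : Measurable wbar)
    (hwconv : ∀ ε : ℝ≥0∞, 0 < ε →
      Tendsto (fun k => Pr {ω | ε ≤ eLpNorm (wh k ω - wbar) 2 ρ}) atTop (𝓝 0)) :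
    -- consistency for fixed `β`
    (∀ (β : ℝ) (Ubar : (S × A) × S → ℝ), Measurable Ubar →
      (∀ ε : ℝ≥0∞, 0 < ε →
        Tendsto (fun k => Pr {ω | ε ≤ eLpNorm (Uh k β ω - Ubar) 2 (ρ ⊗ₘ P)}) atTop (𝓝 0)) →
      (Ubar =ᵐ[ρ ⊗ₘ P] AvgMDP.valueDiff π (Q β) ∨ wbar =ᵐ[ρ] AvgMDP.ratio ρ d π) →
      TendstoInMeasure Pr (fun k => Mh k β) atTop (fun _ => AvgMDP.objective c R d β)) ∧
    -- consistency of the maximum over `β`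
    (∀ Ubar : ℝ → (S × A) × S → ℝ, (∀ β, Measurable (Ubar β)) →
      (∀ β, ∀ ε : ℝ≥0∞, 0 < ε →
        Tendsto (fun k => Pr {ω | ε ≤ eLpNorm (Uh k β ω - Ubar β) 2 (ρ ⊗ₘ P)}) atTop (𝓝 0)) →
      (((∀ β, Ubar β =ᵐ[ρ ⊗ₘ P] AvgMDP.valueDiff π (Q β)) ∧
          ∀ ε : ℝ≥0∞, 0 < ε →
            Tendsto (fun k => Pr {ω | ε ≤ ⨆ β, eLpNorm (Uh k β ω - Ubar β) 2 (ρ ⊗ₘ P)})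
              atTop (𝓝 0)) ∨
        wbar =ᵐ[ρ] AvgMDP.ratio ρ d π) →
      ∃ βstar : ℝ, (∀ β, AvgMDP.objective c R d β ≤ AvgMDP.objective c R d βstar) ∧
        ∀ ε : ℝ, 0 < ε →
          Tendsto (fun k => Pr {ω | ¬ ∃ b, IsLUB (Set.range fun β => Mh k β ω) b ∧
            |b - AvgMDP.objective c R d βstar| < ε}) atTop (𝓝 0)) := by 
  have hR0 : 0 ≤ Rmax := hRmax.le
  set K := AvgMDP.pairKernel P π with hK
  set h : ℝ → S → ℝ := AvgMDP.centeredReward c R d with hh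
  have hhm : ∀ β, Measurable (h β) := AvgMDP.measurable_centeredReward hR
  set bh : ℝ := 4 * Rmax / (1 - c) with hbh
  have hc : 0 < 1 - c := by linarith
  have hbh0 : 0 ≤ bh := by positivity
  have hhb : ∀ β s, |h β s| ≤ bh := AvgMDP.abs_centeredReward_le hR hRb hR0 hc1
  have hac : d ⊗ₘ π ≪ ρ := AvgMDP.compProd_absolutelyContinuous hdm hdens hρ hpmin hdens_min
  have hinv := AvgMDP.invariant_compProd hd
  -- summability of the iterated conditional expectations
  have hf : ∀ β, Measurable fun y : S × A => h β y.1 := fun β => by fun_prop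
  have hfb : ∀ β, ∀ y : S × A, |h β y.1| ≤ bh := fun β y => hhb β _
  have hf0 : ∀ β, ∫ y, h β y.1 ∂(d ⊗ₘ π) = 0 := fun β => by
    rw [AvgMDP.integral_fst_compProd d π (hhm β)]
    exact AvgMDP.integral_centeredReward hR hRb β
  have hsum2 : ∀ β, ∑' k, eLpNorm (AvgMDP.iterMean K (fun y => h β y.1) k) 2 ρ ≠ ⊤ := fun β =>
    AvgMDP.tsum_eLpNorm_iterMean_ne_top hinv hC₃ habar_pos habar hcontr (hf β) (hfb β) (hf0 β)
  have hsum : ∀ β, ∑' k, ∫⁻ x, ‖AvgMDP.iterMean K (fun y => h β y.1) k x‖ₑ ∂ρ ≠ ⊤ := fun β =>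
    ne_top_of_le_ne_top (hsum2 β) (ENNReal.tsum_le_tsum fun k =>
      AvgMDP.lintegral_enorm_le_eLpNorm_two (AvgMDP.measurable_iterMean (hf β) k))
  have hsum' : ∀ β, ∑' k, ∫⁻ x, ‖AvgMDP.iterMean K (fun y => h β y.1) k x‖ₑ ∂(ρ.bind K) ≠ ⊤ :=
    fun β => by
    have h1 : ∀ k, ∫⁻ x, ‖AvgMDP.iterMean K (fun y => h β y.1) k x‖ₑ ∂(ρ.bind K) ≤
        (ENNReal.ofReal (C₃ * abar 1) + ENNReal.ofReal W) *
          eLpNorm (AvgMDP.iterMean K (fun y => h β y.1) k) 2 ρ := fun k =>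
      AvgMDP.lintegral_bind_enorm_le (ν := d ⊗ₘ π)
        (fun f hf hf2 => by simpa only [pow_one] using hcontr 1 le_rfl f hf hf2)
        (fun f hf => AvgMDP.lintegral_compProd_le hac hW hf)
        (AvgMDP.measurable_iterMean (hf β) k) (AvgMDP.abs_iterMean_le (hfb β) k)
    refine ne_top_of_le_ne_top ?_ (ENNReal.tsum_le_tsum h1)
    rw [ENNReal.tsum_mul_left]
    exact ENNReal.mul_ne_top (by simp) (hsum2 β)
  have hQlim : ∀ β x, Tendsto (fun τ => AvgMDP.cesaroSum K (fun y => h β y.1) τ x) atTop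
      (𝓝 (Q β x)) := fun β x => hQ β x
  have hQm : ∀ β, Measurable (Q β) := fun β =>
    measurable_of_tendsto_metrizable (AvgMDP.measurable_cesaroSum (hf β))
      (tendsto_pi_nhds.2 (hQlim β))
  -- the estimators belong to the function classes
  have heG : ∀ k ω, eh k ω ∈ G₂ := fun k ω => (heh k ω).mem
  have hQF : ∀ k β ω, Qh k β ω ∈ F₁ := fun k β ω => (hQh k β ω).mem
  obtain ⟨ω₀⟩ : Nonempty Ω := nonempty_of_isProbabilityMeasure Pr
  obtain ⟨x₀⟩ : Nonempty (S × A) := nonempty_of_isProbabilityMeasure ρ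
  have hF0 : 0 ≤ Fmax := (abs_nonneg _).trans (hF₁.bounded _ (hQF 0 0 ω₀) x₀)
  have hG0 : 0 ≤ Gmax := (abs_nonneg _).trans (hG₂.bounded _ (heG 0 ω₀) x₀)
  have hem : ∀ k ω, Measurable (eh k ω) := fun k ω => hG₂.measurable _ (heG k ω)
  have heb : ∀ k ω x, |eh k ω x| ≤ Gmax := fun k ω => hG₂.bounded _ (heG k ω)
  have hQhm : ∀ k β ω, Measurable (Qh k β ω) := fun k β ω => hF₁.measurable _ (hQF k β ω)
  have hQhb : ∀ k β ω x, |Qh k β ω x| ≤ Fmax := fun k β ω => hF₁.bounded _ (hQF k β ω)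
  -- the uniform law of large numbers
  obtain ⟨M, D, hM⟩ := AvgMDP.exists_penalty_bound hα0 hα1 hN hlam₁ hmu₂
    (u := Gmax ^ 2) (v := (1 + 2 * Fmax + Gmax) ^ 2) (p := (J₁ (Qh 0 0 ω₀) : ℝ) ^ 2)
    (q := (J₂ (eh 0 ω₀) : ℝ) ^ 2) (by positivity) (by positivity) (by positivity) (by positivity)
  have hdev : ∀ ε : ℝ, 0 < ε → Tendsto (fun k => Pr {ω | ∃ β,
      ε ≤ |E k ω (AvgMDP.weightedTd π (h β) (eh k ω) (Qh k β ω)) -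
        ∫ z, AvgMDP.weightedTd π (h β) (eh k ω) (Qh k β ω) z ∂(ρ ⊗ₘ P)|}) atTop (𝓝 0) := by
    intro ε hε
    have h1 := AvgMDP.tendsto_measure_deviation (π := π) hchain hindep hstat hb₀ hb₁ hmix hn hT hN
      hC₄ hF₁ hG₂ hF0 hG0 hbh0 hhb hhm
      (fun ε hε => AvgMDP.exists_net_centeredReward hR hRb hR0 hc1 hε)
      (hM.mono fun k hk => ⟨hk.2.2.1, hk.2.2.2.1⟩) hε
    refine tendsto_of_tendsto_of_tendsto_of_le_of_le' tendsto_const_nhds h1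
      (Eventually.of_forall fun k => zero_le) ?_
    filter_upwards [hM] with k hk
    refine measure_mono ?_
    rintro ω ⟨β, hβ⟩
    have h2 := heh k ω
    have h3 := hQh k β ω
    subst hE
    refine ⟨eh k ω, heG k ω, ?_, Qh k β ω, hQF k β ω, ?_, β, hβ⟩
    · exact le_of_sq_le_sq ((h2.penalty_le (hn k) (hT k) hk.2.1 hF₂.bounded hG₂.bounded
        (heG 0 ω₀)).trans hk.2.2.2.2.2) hk.2.2.1.le
    · exact le_of_sq_le_sq ((h3.penalty_le (hn k) (hT k) hk.1 hG₁.bounded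
        (hQF 0 0 ω₀)).trans hk.2.2.2.2.1) hk.2.2.1.le
  -- consistency, uniformly over a set of values of `β`
  have main : ∀ (B : Set ℝ) (V : ℕ → Ω → ℝ≥0∞),
      (∀ ε : ℝ≥0∞, 0 < ε → Tendsto (fun k => Pr {ω | ε ≤ V k ω}) atTop (𝓝 0)) →
      ((∃ Ubar : ℝ → (S × A) × S → ℝ, ∀ β ∈ B, Ubar β =ᵐ[ρ ⊗ₘ P] AvgMDP.valueDiff π (Q β) ∧
        ∀ k ω, eLpNorm (Uh k β ω - Ubar β) 2 (ρ ⊗ₘ P) ≤ V k ω) ∨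
        (wbar =ᵐ[ρ] AvgMDP.ratio ρ d π ∧ ∀ k ω, eLpNorm (wh k ω - wbar) 2 ρ ≤ V k ω)) →
      ∀ ε : ℝ, 0 < ε →
        Tendsto (fun k => Pr {ω | ∃ β ∈ B, ε ≤ |Mh k β ω - AvgMDP.objective c R d β|})
          atTop (𝓝 0) := by
    intro B V hV hcase ε hε
    refine AvgMDP.tendsto_measure_exists_ge (a := fun k ω => E k ω fun z => eh k ω z.1)
      (x := fun k β ω => Mh k β ω - AvgMDP.objective c R d β)
      (s := fun k β ω => E k ω (AvgMDP.weightedTd π (h β) (eh k ω) (Qh k β ω)))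
      (p := fun k β ω => ∫ z, AvgMDP.weightedTd π (h β) (eh k ω) (Qh k β ω) z ∂(ρ ⊗ₘ P))
      (fun k β ω hne => ?_) hnorm hdev hV (fun κ hκ => ?_) hε
    · subst hE hUh hwh hMh
      exact AvgMDP.objectiveEstimator_sub_objective _ _ _ c R d β hne
    · rcases hcase with ⟨Ubar, hU⟩ | ⟨hw, hwV⟩
      · refine ⟨κ⁻¹ * Gmax + 1, by positivity, fun k ω ha β hβ => ?_⟩
        obtain ⟨hU1, hU2⟩ := hU β hβ
        obtain ⟨hi, h0⟩ := AvgMDP.integral_weightedTd_relativeValue (P := P) (ρ := ρ) (hhm β) (hhb β)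
          (hem k ω) (heb k ω) (hQlim β) (hsum β) (hsum' β)
        have h1 := AvgMDP.enorm_integral_weightedTd_le_valueDiff (hhm β) (hhb β) (hem k ω)
          (heb k ω) (hQm β) (hQhm k β ω) (hQhb k β ω) hU1 hi h0
        have h2 := hU2 k ω
        rw [hUh] at h2
        rw [enorm_mul]
        have h3 : ‖(E k ω fun z => eh k ω z.1)⁻¹‖ₑ ≤ ENNReal.ofReal κ⁻¹ := by
          rw [Real.enorm_eq_ofReal_abs, abs_inv]
          exact ENNReal.ofReal_le_ofReal (inv_anti₀ hκ ha)
        calc _ ≤ ENNReal.ofReal κ⁻¹ * (ENNReal.ofReal Gmax * V k ω) :=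
              mul_le_mul' h3 (h1.trans (mul_le_mul_right h2 _))
          _ = ENNReal.ofReal (κ⁻¹ * Gmax) * V k ω := by
              rw [← mul_assoc, ← ENNReal.ofReal_mul (by positivity)]
          _ ≤ _ := by gcongr; linarith
      · refine ⟨bh + 2 * Fmax + 1, by positivity, fun k ω ha β hβ => ?_⟩
        set a := E k ω fun z => eh k ω z.1 with hadef
        obtain ⟨hi, h0⟩ := AvgMDP.integral_weightedTd_ratio hd hac hW (hhm β) (hhb β)
          (AvgMDP.integral_centeredReward hR hRb β) (hQhm k β ω) (hQhb k β ω)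
        have hwm : Measurable (wh k ω) := by
          rw [hwh]; exact (hem k ω).div_const _
        have hwb : ∀ x, |wh k ω x| ≤ Gmax / |a| := fun x => by
          simp only [hwh, AvgMDP.ratioEstimator, ← hadef, abs_div]
          gcongr
          exact heb k ω x
        have h1 := AvgMDP.enorm_integral_weightedTd_le_weight (P := P) (hhm β) (hhb β) hwm hwb
          (Measure.measurable_rnDeriv _ _).ennreal_toReal (hQhm k β ω) (hQhb k β ω) hw hi h0
        have h2 : a⁻¹ * ∫ z, AvgMDP.weightedTd π (h β) (eh k ω) (Qh k β ω) z ∂(ρ ⊗ₘ P) =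
            ∫ z, AvgMDP.weightedTd π (h β) (wh k ω) (Qh k β ω) z ∂(ρ ⊗ₘ P) := by
          rw [← integral_const_mul]
          refine integral_congr_ae (ae_of_all _ fun z => ?_)
          simp only [hwh, AvgMDP.weightedTd, AvgMDP.ratioEstimator, ← hadef]
          ring
        rw [h2]
        refine h1.trans (mul_le_mul' (ENNReal.ofReal_le_ofReal (by linarith)) (hwV k ω))
  refine ⟨fun β Ubar hUm hU hor => ?_, fun Ubar hUm hU hor => ?_⟩
  · have h1 : ∀ ε : ℝ, 0 < ε → Tendsto (fun k => Pr {ω | ∃ β' ∈ ({β} : Set ℝ),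
        ε ≤ |Mh k β' ω - AvgMDP.objective c R d β'|}) atTop (𝓝 0) := by
      rcases hor with hor | hor
      · refine main {β} _ hU (Or.inl ⟨fun _ => Ubar, fun β' hβ' => ?_⟩)
        rw [Set.mem_singleton_iff.1 hβ']
        exact ⟨hor, fun k ω => le_rfl⟩
      · exact main {β} _ hwconv (Or.inr ⟨hor, fun k ω => le_rfl⟩)
    rw [tendstoInMeasure_iff_norm]
    intro ε hε
    simpa [Real.norm_eq_abs] using h1 ε hε
  · obtain ⟨βstar, hβ⟩ := AvgMDP.exists_isMax_objective (d := d) hR hRb hR0 hc0 hc1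
    refine ⟨βstar, hβ, fun ε hε => ?_⟩
    have h1 : ∀ ε : ℝ, 0 < ε → Tendsto (fun k => Pr {ω | ∃ β ∈ (Set.univ : Set ℝ),
        ε ≤ |Mh k β ω - AvgMDP.objective c R d β|}) atTop (𝓝 0) := by
      rcases hor with ⟨hor, hsup⟩ | hor
      · exact main Set.univ _ hsup (Or.inl ⟨Ubar, fun β _ => ⟨hor β, fun k ω =>
          le_iSup (fun β => eLpNorm (Uh k β ω - Ubar β) 2 (ρ ⊗ₘ P)) β⟩⟩)
      · exact main Set.univ _ hwconv (Or.inr ⟨hor, fun k ω => le_rfl⟩)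
    refine tendsto_of_tendsto_of_tendsto_of_le_of_le tendsto_const_nhds
      (h1 (ε / 2) (by positivity)) (fun k => zero_le) fun k => measure_mono fun ω hω => ?_
    by_contra hcon
    simp only [Set.mem_ofPred_eq, Set.mem_univ, true_and, not_exists, not_le] at hcon
    exact hω (AvgMDP.exists_isLUB_of_forall_abs_sub_lt hβ hε hcon)
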